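/- Let $m>n$, let $X\subset\mathbb R^m$ be open and bounded, and let $Y\subset\mathbb R^n$ be non-empty, open, bounded and convex. Write $\mathcal P(\bar Y)$ for the Borel probability measures on $\bar Y$, and $\mathcal W_1(\nu_1,\nu_0)=\inf_{\gamma\in\Pi(\nu_1,\nu_0)}\int|y-z|\,d\gamma$, where $\Pi$ denotes the set of transport plans with the given marginals. Let $c$ be continuous on $\bar X\times\bar Y$ and $C^2$ on $X\times\bar Y$, let $V\in C^2(\bar Y)$, and let $W\in C^2(\bar Y\times\bar Y)$ satisfy $W(y,z)=W(z,y)$. For $\nu\in\mathcal P(\bar Y)$ put $$F_{V,W}[\nu](y)=V(y)+\int W(y,z)\,d\nu(z).$$ Assume that for all $x\in X$, $z\in Y$, $y\in\partial Y$ and every outward unit normal $\mathbf n$ of $Y$ at $y$ (that is, $|\mathbf n|=1$ and $\mathbf n\cdot(y'-y)\le 0$ for all $y'\in Y$), $$[D_yc(x,y)+DV(y)+D_yW(y,z)]\cdot\mathbf n\ge 0.$$ Let $B_\nu:X\to\bar Y$ be the map given by $$D_yc(x,B_\nu(x))+DF_{V,W}[\nu](B_\nu(x))=0 .$$ (Its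 existence and uniqueness are part of the conclusion.) Suppose there are constants $\eta,\lambda,k>0$ and $M,C\ge 0$ such that 1. $D^2_{yy}c(x,y)\ge\eta\,\mathrm{Id}$ and $D^2_{xy}c(x,y)$ has rank $n$ for all $(x,y)\in X\times Y$; 2. $D^2F_{V,W}[\nu]\ge\lambda\,\mathrm{Id}$ in $Y$, for all $\nu\in\mathcal P(\bar Y)$; 3. $\mathcal H^{m-n}(B_\nu^{-1}(y))\le M$ for all $y\in Y$ and all $\nu\in\mathcal P(\bar Y)$, where $\mathcal H^{m-n}$ is the Hausdorff measure normalized to agree with Lebesgue measure on $\mathbb R^{m-n}$; 4. $JB_\nu\ge k$ in $X$ for all $\nu\in\mathcal P(\bar Y)$, where $JB_\nu=\sqrt{\det(DB_\nu DB_\nu^{T})}$ is the $n$-dimensional Jacobian; 5. $\int_Y|DF_{V,W}[\nu_1]-DF_{V,W}[\nu_0]|\,dy\le C\,\mathcal W_1(\nu_1,\nu_0)$ for all $\nu_0,\nu_1\in\mathcal P(\bar Y)$. Let $\mu$ be a probability measure on $X$, absolutely continuous with respect to Lebesgue measure, and let $\|\mu\|_\infty$ be the essential supremum of its density. Assume $\|\mu\|_\infty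 MC<k(\eta+\lambda)$ (with the convention $\infty\cdot 0=0$). Then for every $\nu\in\mathcal P(\bar Y)$ and $x\in X$ the equation defining $B_\nu(x)$ has exactly one solution in $\bar Y$. The best-reply map $\mathcal B(\nu)=(B_\nu)_\#\mu$ maps $\mathcal P(\bar Y)$ into itself and is a contraction for $\mathcal W_1$: there is $q\in[0,1)$ with $\mathcal W_1(\mathcal B(\nu_1),\mathcal B(\nu_0))\le q\,\mathcal W_1(\nu_1,\nu_0)$ for all $\nu_0,\nu_1\in\mathcal P(\bar Y)$. Moreover $\mathcal B$ has exactly one fixed point $\nu^\star$ in $\mathcal P(\bar Y)$, and $\nu^\star$ minimizes $$\nu\mapsto \inf_{\gamma\in\Pi(\mu,\nu)}\int c\,d\gamma+\int V\,d\nu+\frac12\iint W(y,z)\,d\nu(z)\,d\nu(y)$$ over $\mathcal P(\bar Y)$. -/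

import Mathlib

open MeasureTheory Set
open scoped ENNReal NNReal

noncomputable section

namespace BestReply

/-- Euclidean space `ℝᵈ`. -/
abbrev E (d : ℕ) : Type := EuclideanSpace ℝ (Fin d)

/-- Borel probability measures on `ℝᵈ` that give full mass to `S`. -/
def probOn {d : ℕ} (S : Set (E d)) : Set (Measure (E d)) :=
  {ν | IsProbabilityMeasure ν ∧ ν Sᶜ = 0}

/-- Transport plans: measures on the product with marginals `μ` and `ν`. -/
def plans {d e : ℕ} (μ : Measure (E d)) (ν : Measure (E e)) : Set (Measure (E d × E e)) :=
  {γ | γ.map Prod.fst = μ ∧ γ.map Prod.snd = ν}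

/-- The optimal transport cost `T_c(μ, ν)` for a real-valued cost `c`. -/
def transportCost {d e : ℕ} (c : E d → E e → ℝ) (μ : Measure (E d)) (ν : Measure (E e)) : ℝ :=
  sInf ((fun γ : Measure (E d × E e) => ∫ p, c p.1 p.2 ∂γ) '' plans μ ν)

/-- The 1-Wasserstein distance: the optimal transport cost for the cost `|y - z|`. -/
def W1 {d : ℕ} (ν₁ ν₀ : Measure (E d)) : ℝ≥0∞ :=
  ⨅ γ ∈ plans ν₁ ν₀, ∫⁻ p, edist p.1 p.2 ∂γ

/-- `T_c(μ, ν) + ∫ V dν + (1/2) ∫∫ W(y, z) dν(z) dν(y)`. -/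
def energy {m n : ℕ} (c : E m → E n → ℝ) (V : E n → ℝ) (W : E n → E n → ℝ)
    (μ : Measure (E m)) (ν : Measure (E n)) : ℝ :=
  transportCost c μ ν + (∫ y, V y ∂ν) + (1 / 2) * (∫ y, (∫ z, W y z ∂ν) ∂ν)

/-- The first variation `F_{V,W}[ν](y) = V(y) + ∫ W(y, z) dν(z)`. -/
def firstVar {n : ℕ} (V : E n → ℝ) (W : E n → E n → ℝ) (ν : Measure (E n)) (y : E n) : ℝ :=
  V y + ∫ z, W y z ∂ν

/-- The gradient of `f` at a point `y` of the closure of `Y` (one-sided at the boundary; for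
convex open nonempty `Y` and `f` differentiable up to the boundary it is uniquely determined, and it
is the ordinary gradient at points of `Y`). -/
def grad {n : ℕ} (Y : Set (E n)) (f : E n → ℝ) (y : E n) : E n :=
  gradientWithin f (closure Y) y

/-- The Hessian quadratic form `D²f(y)(v, v)`. -/
def hess {n : ℕ} (Y : Set (E n)) (f : E n → ℝ) (y v : E n) : ℝ :=
  inner ℝ (fderivWithin ℝ (grad Y f) (closure Y) y v) v

/-- The mixed derivative `D²_{xy} c(x, y)`, as the `x`-differential of `D_y c(x, y)`. -/
def mixed {m n : ℕ} (Y : Set (E n)) (c : E m → E n → ℝ) (x : E m) (y : E n) : E m →L[ℝ] E n :=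
  fderiv ℝ (fun x' => grad Y (c x') y) x

/-- `e` is an outward unit normal of the convex set `Y` at `y`. -/
def IsOutwardUnitNormal {n : ℕ} (Y : Set (E n)) (y e : E n) : Prop :=
  ‖e‖ = 1 ∧ ∀ z ∈ Y, inner ℝ e (z - y) ≤ 0

/-- `y` is a point of the closure of `Y` with `D_y c(x, y) + D F_{V,W}[ν](y) = 0`. -/
def IsReply {m n : ℕ} (Y : Set (E n)) (c : E m → E n → ℝ) (V : E n → ℝ) (W : E n → E n → ℝ)
    (ν : Measure (E n)) (x : E m) (y : E n) : Prop :=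
  y ∈ closure Y ∧ grad Y (c x) y + grad Y (firstVar V W ν) y = 0

open Classical in
/-- The map `B_ν`: `B_ν(x)` is the solution `y` of `D_y c(x, y) + D F_{V,W}[ν](y) = 0`
(the value is irrelevant where there is none). -/
def reply {m n : ℕ} (Y : Set (E n)) (c : E m → E n → ℝ) (V : E n → ℝ) (W : E n → E n → ℝ)
    (ν : Measure (E n)) (x : E m) : E n :=
  if h : ∃ y, IsReply Y c V W ν x y then h.choose else 0

/-- The best-reply map `ν ↦ (B_ν)_# μ`. -/
def bestReply {m n : ℕ} (Y : Set (E n)) (c : E m → E n → ℝ) (V : E n → ℝ) (W : E n → E n → ℝ)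
    (μ : Measure (E m)) (ν : Measure (E n)) : Measure (E n) :=
  μ.map (reply Y c V W ν)

/-- The `n`-dimensional Jacobian `√det(L Lᵀ)` of a linear map `L : ℝᵐ → ℝⁿ`. -/
def jac {m n : ℕ} (L : E m →L[ℝ] E n) : ℝ :=
  Real.sqrt (L.comp (ContinuousLinearMap.adjoint L)).det

end BestReply

end

namespace BestReply

/-! The reply `B_ν(x)` is the unique minimizer of `c(x, ·) + F[ν]` on the closure of `Y`.
Compactness gives a minimizer, the boundary condition makes every minimizer a critical point, and
strong monotonicity of the two gradients leaves room for only one critical point. The same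
monotonicity gives stability (`norm_sub_le_of_isReply`): `(η + λ)|B_{ν₁}(x) - B_{ν₀}(x)|` is at most
`|DF[ν₁] - DF[ν₀]|` evaluated at `B_{ν₀}(x)`.

Integrate this against `μ`, which is at most `‖μ‖_∞` times Lebesgue measure on `X`. The coarea
inequality `mul_lintegral_comp_le_of_le_jac` replaces the integral over `X` by `M / k` times an
integral over `Y`, where the Lipschitz hypothesis applies. Coupling the two push-forwards through
the common variable `x` gives the contraction factor `‖μ‖_∞ M C / (k (η + λ))`.

The fixed point does not come from Banach's theorem. A plan `γ` minimizing the energy among plans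
with first marginal `μ` exists by weak compactness; its first-order condition says that `γ`
minimizes the linear functional with integrand `c + F[ν]`, where `ν` is its second marginal
(`exists_plan_minimizer`). Such a plan must live on the graph of `B_ν` (`eq_map_of_plan_le`), so `ν`
is a fixed point and minimizes the energy. The contraction is then used only for uniqueness. -/

/-! ### A coarea inequality for maps with Jacobian bounded below -/

/-- The product type carries the sup norm, so the isometry is expressed through inner products. -/
theorem exists_prodEquiv {m n : ℕ} (h : n ≤ m) :
    ∃ j : (E n × E (m - n)) ≃L[ℝ] E m, MeasurePreserving j ∧
      ∀ p q, inner ℝ (j p) (j q) = inner ℝ p.1 q.1 + inner ℝ p.2 q.2 := by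
  have hd : Module.finrank ℝ (WithLp 2 (E n × E (m - n))) = m := by
    rw [(WithLp.linearEquiv 2 ℝ (E n × E (m - n))).finrank_eq]
    simp [h]
  let e : WithLp 2 (E n × E (m - n)) ≃ₗᵢ[ℝ] E m :=
    ((stdOrthonormalBasis ℝ (WithLp 2 (E n × E (m - n)))).reindex (finCongr hd)).repr
  refine ⟨(WithLp.prodContinuousLinearEquiv 2 ℝ (E n) (E (m - n))).symm.trans
    e.toContinuousLinearEquiv, ?_, ?_⟩
  · exact e.measurePreserving.comp (WithLp.volume_preserving_toLp (U := E n) (V := E (m - n)))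
  · intro p q
    simp [WithLp.prod_inner_apply]

theorem surjective_of_jac_pos {m n : ℕ} {A : E m →L[ℝ] E n} (hA : 0 < jac A) :
    Function.Surjective A := by
  have hdet : (A.comp (ContinuousLinearMap.adjoint A)).det ≠ 0 := by
    intro h0
    simp [jac, h0] at hA
  have := (LinearEquiv.ofIsUnitDet (f := (A.comp (ContinuousLinearMap.adjoint A)).toLinearMap)
      (v := Module.finBasis ℝ _) (v' := Module.finBasis ℝ _)
      (by rw [LinearMap.det_toMatrix]; exact isUnit_iff_ne_zero.2 hdet)).surjective
  intro y
  obtain ⟨x, hx⟩ := this y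
  exact ⟨_, hx⟩

/-- Take for `Q` the orthogonal projection onto `ker A`, read in orthonormal coordinates. Since `A`
kills `ker A` and `Q` kills the range of `Aᵀ`, the map `L = j ∘ (A, Q)` has `L Lᵀ` conjugate to `A
Aᵀ ⊕ id`, whence `(det L)² = det (A Aᵀ)`. -/
theorem exists_ker_coordinates {m n : ℕ} (j : (E n × E (m - n)) ≃L[ℝ] E m)
    (hj : ∀ p q, inner ℝ (j p) (j q) = inner ℝ p.1 q.1 + inner ℝ p.2 q.2)
    (A : E m →L[ℝ] E n) (hA : 0 < jac A) :
    ∃ Q : E m →L[ℝ] E (m - n), LipschitzWith 1 Q ∧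
      |((j : (E n × E (m - n)) →L[ℝ] E m).comp (A.prod Q)).det| = jac A := by
  have hsurj := surjective_of_jac_pos hA
  have hk : Module.finrank ℝ (LinearMap.ker A.toLinearMap) = m - n := by
    have h1 := LinearMap.finrank_range_add_finrank_ker A.toLinearMap
    rw [LinearMap.range_eq_top.2 hsurj] at h1
    simp at h1
    omega
  let K := LinearMap.ker A.toLinearMap
  let e : K ≃ₗᵢ[ℝ] E (m - n) := ((stdOrthonormalBasis ℝ K).reindex (finCongr hk)).repr
  let Q : E m →L[ℝ] E (m - n) :=
    (e.toContinuousLinearEquiv : K →L[ℝ] E (m - n)).comp K.orthogonalProjectionOnto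
  have hQK : ∀ v : K, Q v = e v := fun v => by simp [Q]
  have hQi : ∀ x v, inner ℝ (Q x) v = inner ℝ x (e.symm v : E m) := by
    intro x v
    rw [← e.symm.inner_map_map]
    simp [Q]
  refine ⟨Q, ?_, ?_⟩
  · refine LipschitzWith.of_dist_le_mul fun x y => ?_
    rw [dist_eq_norm, dist_eq_norm, ← map_sub]
    have := K.norm_orthogonalProjectionOnto_apply_le (x - y)
    simpa only [NNReal.coe_one, one_mul, Q, ContinuousLinearMap.comp_apply,
      LinearIsometryEquiv.coe_toContinuousLinearEquiv, ContinuousLinearEquiv.coe_coe,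
      LinearIsometryEquiv.norm_map] using this
  · set L := (j : (E n × E (m - n)) →L[ℝ] E m).comp (A.prod Q) with hL
    let R : (E n × E (m - n)) →ₗ[ℝ] E m :=
      (ContinuousLinearMap.adjoint A).toLinearMap.coprod
        (K.subtype ∘ₗ e.symm.toLinearEquiv.toLinearMap)
    have hadj : LinearMap.adjoint L.toLinearMap = R ∘ₗ j.symm.toLinearEquiv.toLinearMap := by
      symm
      rw [LinearMap.eq_adjoint_iff]
      intro x y
      obtain ⟨p, rfl⟩ := j.surjective x
      have : inner ℝ (j p) (L y) = inner ℝ p.1 (A y) + inner ℝ p.2 (Q y) := by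
        simp [hL, hj]
      simp only [LinearMap.coe_comp, Function.comp_apply, ContinuousLinearMap.coe_coe, this]
      have hq := hQi y p.2
      simp only [R, LinearMap.coprod_apply, inner_add_left, LinearEquiv.coe_coe,
        ContinuousLinearEquiv.coe_toLinearEquiv, ContinuousLinearEquiv.symm_apply_apply,
        ContinuousLinearMap.coe_coe, ContinuousLinearMap.adjoint_inner_left, LinearMap.comp_apply,
        Submodule.subtype_apply, LinearIsometryEquiv.coe_toLinearEquiv]
      rw [real_inner_comm y, real_inner_comm (Q y), hq]
    have hcomp : (A.prod Q).toLinearMap ∘ₗ R =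
        (A.comp (ContinuousLinearMap.adjoint A)).toLinearMap.prodMap LinearMap.id := by
      have hAK : ∀ v : K, A v = 0 := fun v => v.2
      have hQA : ∀ u, Q (ContinuousLinearMap.adjoint A u) = 0 := by
        intro u
        refine ext_inner_right ℝ fun v => ?_
        rw [hQi, ContinuousLinearMap.adjoint_inner_left, hAK]
        simp
      refine LinearMap.ext fun p => ?_
      ext1
      · simp [R, hAK]
      · simp [R, hQA, hQK]
    have hsq : L.det * L.det = (A.comp (ContinuousLinearMap.adjoint A)).det := by
      have h1 : LinearMap.det (LinearMap.adjoint L.toLinearMap) = L.det := by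
        rw [ContinuousLinearMap.det, ← LinearMap.det_toMatrix (stdOrthonormalBasis ℝ (E m)).toBasis,
          ← LinearMap.det_toMatrix (stdOrthonormalBasis ℝ (E m)).toBasis L.toLinearMap,
          LinearMap.toMatrix_adjoint, Matrix.det_conjTranspose]
        simp
      calc L.det * L.det = LinearMap.det (L.toLinearMap ∘ₗ LinearMap.adjoint L.toLinearMap) := by
            rw [LinearMap.det_comp, h1]
        _ = LinearMap.det (j.toLinearEquiv.toLinearMap ∘ₗ ((A.prod Q).toLinearMap ∘ₗ R) ∘ₗ
              j.toLinearEquiv.symm.toLinearMap) := by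
            rw [hadj]; rfl
        _ = _ := by
            rw [LinearMap.det_conj, hcomp, LinearMap.det_prodMap, LinearMap.det_id, mul_one]
    rw [jac, ← hsq, Real.sqrt_mul_self_eq_abs]

theorem norm_prodEquiv_inl {m n : ℕ} (j : (E n × E (m - n)) ≃L[ℝ] E m)
    (hj : ∀ p q, inner ℝ (j p) (j q) = inner ℝ p.1 q.1 + inner ℝ p.2 q.2) (u : E n) :
    ‖j (u, 0)‖ = ‖u‖ := by
  rw [← sq_eq_sq₀ (norm_nonneg _) (norm_nonneg _), ← real_inner_self_eq_norm_sq,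
    ← real_inner_self_eq_norm_sq, hj]
  simp

/-- Invertibility and a lower bound on the determinant are open conditions: they pass from `j ∘ (A,
Q)` to the completed map `j ∘ (f, Q)` when `f` is close to `A`. The loss from `k` to `k'` pays for
the perturbation. -/
theorem exists_radius {m n : ℕ} (j : (E n × E (m - n)) ≃L[ℝ] E m)
    (hj : ∀ p q, inner ℝ (j p) (j q) = inner ℝ p.1 q.1 + inner ℝ p.2 q.2)
    {k k' : ℝ} (hk' : 0 < k') (hkk : k' < k) (A : E m →L[ℝ] E n) :
    ∃ r : ℝ≥0, r ≠ 0 ∧ (k ≤ jac A → ∃ Q : E m →L[ℝ] E (m - n), LipschitzWith 1 Q ∧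
      ∀ (f : E m → E n) (s : Set (E m)), MeasurableSet s → ApproximatesLinearOn f A s r →
        InjOn (fun x => j (f x, Q x)) s ∧
        ∀ f' : E m → E m →L[ℝ] E n, (∀ x ∈ s, HasFDerivWithinAt f (f' x) s x) →
          ∀ᵐ x ∂volume.restrict s,
            k' ≤ |((j : (E n × E (m - n)) →L[ℝ] E m).comp ((f' x).prod Q)).det|) := by
  by_cases hA : k ≤ jac A
  swap
  -- A dummy radius: the partition lemma asks for one at every linear map, but on a nonempty set it
  -- only uses derivatives of `f`.
  · exact ⟨1, one_ne_zero, fun h => absurd h hA⟩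
  obtain ⟨Q, hQ, hdet⟩ := exists_ker_coordinates j hj A (hk'.trans (hkk.trans_le hA))
  set L := (j : (E n × E (m - n)) →L[ℝ] E m).comp (A.prod Q) with hL
  have hL0 : L.det ≠ 0 := by
    intro h0
    rw [h0, abs_zero] at hdet
    linarith
  let e : E m ≃L[ℝ] E m := L.toContinuousLinearEquivOfDetNeZero hL0
  have he : (e : E m →L[ℝ] E m) = L := L.coe_toContinuousLinearEquivOfDetNeZero hL0
  have hopen : IsOpen {B : E m →L[ℝ] E m | k' < |B.det|} :=
    isOpen_lt continuous_const ContinuousLinearMap.continuous_det.abs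
  obtain ⟨ε, hε, hball⟩ := Metric.isOpen_iff.1 hopen L
    (by show k' < |L.det|; rw [hdet]; exact hkk.trans_le hA)
  -- Smallness against `ε` controls the determinant; smallness against the inverse of `L` gives
  -- injectivity.
  obtain ⟨r, hr0, hrε, hri⟩ : ∃ r : ℝ≥0, 0 < r ∧ (r : ℝ) < ε ∧
      (Subsingleton (E m) ∨ r < ‖(e.symm : E m →L[ℝ] E m)‖₊⁻¹) := by
    rcases e.subsingleton_or_nnnorm_symm_pos with h | h
    · exact ⟨⟨ε / 2, by positivity⟩, half_pos (a := (⟨ε, hε.le⟩ : ℝ≥0)) hε, half_lt_self hε, Or.inl h⟩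
    · have h2 : 0 < min ⟨ε, hε.le⟩ ‖(e.symm : E m →L[ℝ] E m)‖₊⁻¹ := lt_min hε (by positivity)
      obtain ⟨r, h0, hr⟩ := exists_between h2
      exact ⟨r, h0, (lt_min_iff.1 hr).1, Or.inr (lt_min_iff.1 hr).2⟩
  refine ⟨r, hr0.ne', fun _ => ⟨Q, hQ, fun f s hs hf => ?_⟩⟩
  have happ : ApproximatesLinearOn (fun x => j (f x, Q x)) L s r := by
    intro x hx y hy
    have : j (f x, Q x) - j (f y, Q y) - L (x - y) = j (f x - f y - A (x - y), 0) := by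
      simp [hL, ← map_sub]
    rw [this, norm_prodEquiv_inl j hj]
    exact hf x hx y hy
  refine ⟨(he.symm ▸ happ : ApproximatesLinearOn _ (e : E m →L[ℝ] E m) s r).injOn hri,
    fun f' hf' => ?_⟩
  filter_upwards [happ.norm_fderiv_sub_le volume hs
    (fun x => (j : (E n × E (m - n)) →L[ℝ] E m).comp ((f' x).prod Q)) fun x hx =>
      j.hasFDerivAt.comp_hasFDerivWithinAt x ((hf' x hx).prodMk Q.hasFDerivWithinAt)] with x hx
  refine le_of_lt (hball ?_)
  rw [Metric.mem_ball, dist_eq_norm]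
  exact lt_of_le_of_lt hx hrε

/-- Change variables by `Φ = j ∘ (f, Q)` and apply Tonelli to the image. The slice over `y` lies in
the `Q`-image of the fibre of `f`, and `Q` is 1-Lipschitz. Taking the slice volume for `h` makes
measurability in `y` automatic, with no need to know it for the Hausdorff measure of fibres. -/
theorem lintegral_piece_le {m n : ℕ} (j : (E n × E (m - n)) ≃L[ℝ] E m)
    (hjm : MeasurePreserving j) {k' : ℝ} (Q : E m →L[ℝ] E (m - n)) (hQ : LipschitzWith 1 Q)
    {f : E m → E n} {f' : E m → E m →L[ℝ] E n} {s : Set (E m)} (hs : MeasurableSet s)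
    (hf' : ∀ x ∈ s, HasFDerivWithinAt f (f' x) s x) (hinj : InjOn (fun x => j (f x, Q x)) s)
    (hdet : ∀ᵐ x ∂volume.restrict s,
      k' ≤ |((j : (E n × E (m - n)) →L[ℝ] E m).comp ((f' x).prod Q)).det|) :
    ∃ h : E n → ℝ≥0∞, Measurable h ∧
      (∀ y, h y ≤ Measure.euclideanHausdorffMeasure (m - n) (s ∩ f ⁻¹' {y})) ∧
      ∀ g : E n → ℝ≥0∞, Measurable g →
        ENNReal.ofReal k' * ∫⁻ x in s, g (f x) ≤ ∫⁻ y, g y * h y := by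
  set Φ : E m → E m := fun x => j (f x, Q x) with hΦ
  have hΦ' : ∀ x ∈ s, HasFDerivWithinAt Φ
      ((j : (E n × E (m - n)) →L[ℝ] E m).comp ((f' x).prod Q)) s x := fun x hx =>
    j.hasFDerivAt.comp_hasFDerivWithinAt x ((hf' x hx).prodMk Q.hasFDerivWithinAt)
  have himg : MeasurableSet (Φ '' s) := measurable_image_of_fderivWithin hs hΦ' hinj
  set T : Set (E n × E (m - n)) := j ⁻¹' (Φ '' s)
  have hT : MeasurableSet T := j.continuous.measurable himg
  refine ⟨fun y => volume (Prod.mk y ⁻¹' T), measurable_measure_prodMk_left hT, fun y => ?_,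
    fun g hg => ?_⟩
  · have hsub : Prod.mk y ⁻¹' T ⊆ Q '' (s ∩ f ⁻¹' {y}) := by
      rintro z ⟨x, hx, hxz⟩
      have := j.injective hxz
      simp only [Prod.mk.injEq] at this
      exact ⟨x, ⟨hx, this.1⟩, this.2⟩
    refine (measure_mono hsub).trans ?_
    rw [← EuclideanSpace.euclideanHausdorffMeasure_eq_volume,
      Measure.euclideanHausdorffMeasure_def, Measure.euclideanHausdorffMeasure_def,
      Measure.smul_apply, Measure.smul_apply]
    gcongr
    have := hQ.hausdorffMeasure_image_le (d := ((m - n : ℕ) : ℝ)) (by positivity) (s ∩ f ⁻¹' {y})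
    simpa using this
  · have hG : Measurable fun w => g (j.symm w).1 :=
      hg.comp (measurable_fst.comp j.symm.continuous.measurable)
    calc ENNReal.ofReal k' * ∫⁻ x in s, g (f x)
        ≤ ∫⁻ x in s, ENNReal.ofReal |((j : (E n × E (m - n)) →L[ℝ] E m).comp
            ((f' x).prod Q)).det| * g (j.symm (Φ x)).1 := by
          rw [← lintegral_const_mul' _ _ ENNReal.ofReal_ne_top]
          refine lintegral_mono_ae ?_
          filter_upwards [hdet] with x hx
          simp only [hΦ, ContinuousLinearEquiv.symm_apply_apply]
          gcongr
      _ = ∫⁻ w in Φ '' s, g (j.symm w).1 :=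
          (lintegral_image_eq_lintegral_abs_det_fderiv_mul volume hs hΦ' hinj
            fun w => g (j.symm w).1).symm
      _ = ∫⁻ p in T, g p.1 := by
          rw [← hjm.setLIntegral_comp_preimage himg hG]
          simp [T]
      _ = ∫⁻ p, T.indicator (fun p => g p.1) p := (lintegral_indicator hT _).symm
      _ = ∫⁻ y, ∫⁻ z, T.indicator (fun p => g p.1) (y, z) :=
          lintegral_prod _ ((hg.comp measurable_fst).indicator hT).aemeasurable
      _ = ∫⁻ y, g y * volume (Prod.mk y ⁻¹' T) := by
          refine lintegral_congr fun y => ?_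
          rw [← setLIntegral_const, ← lintegral_indicator (measurable_prodMk_left hT)]
          rfl
      _ ≤ _ := le_rfl

/-- The inequality half of the coarea formula, for maps with Jacobian bounded below. -/
theorem mul_lintegral_comp_le_of_le_jac {m n : ℕ} (hnm : n ≤ m) {f : E m → E n}
    {f' : E m → E m →L[ℝ] E n} {s : Set (E m)} (hs : MeasurableSet s)
    (hf' : ∀ x ∈ s, HasFDerivWithinAt f (f' x) s x) {k : ℝ} (hk : 0 < k)
    (hjac : ∀ x ∈ s, k ≤ jac (f' x)) {t : Set (E n)} (ht : MeasurableSet t) (hst : MapsTo f s t)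
    {M : ℝ≥0∞} (hM : ∀ y ∈ t, Measure.euclideanHausdorffMeasure (m - n) (s ∩ f ⁻¹' {y}) ≤ M)
    {g : E n → ℝ≥0∞} (hg : Measurable g) :
    ENNReal.ofReal k * ∫⁻ x in s, g (f x) ≤ M * ∫⁻ y in t, g y := by
  rcases s.eq_empty_or_nonempty with rfl | hne
  · simp
  obtain ⟨j, hjm, hj⟩ := exists_prodEquiv hnm
  suffices H : ∀ k', 0 < k' → k' < k →
      ENNReal.ofReal k' * ∫⁻ x in s, g (f x) ≤ M * ∫⁻ y in t, g y by
    refine ENNReal.mul_le_of_forall_lt fun a ha b hb => ?_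
    have hat : a ≠ ∞ := ne_top_of_lt ha
    rcases eq_or_ne a 0 with rfl | ha0
    · simp
    have hlt : a.toReal < k := by
      rwa [← ENNReal.ofReal_lt_ofReal_iff hk, ENNReal.ofReal_toReal hat]
    have := H a.toReal (ENNReal.toReal_pos ha0 hat) hlt
    rw [ENNReal.ofReal_toReal hat] at this
    exact le_trans (by gcongr) this
  intro k' hk' hkk
  choose r hr0 hr using exists_radius j hj hk' hkk
  obtain ⟨t', A, hdisj, hmeas, hcov, happ, hA⟩ :=
    exists_partition_approximatesLinearOn_of_hasFDerivWithinAt f s f' hf' r hr0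
  have hpiece : ∀ i, ∃ h : E n → ℝ≥0∞, Measurable h ∧
      (∀ y, h y ≤ Measure.euclideanHausdorffMeasure (m - n) (s ∩ t' i ∩ f ⁻¹' {y})) ∧
      ∀ g : E n → ℝ≥0∞, Measurable g →
        ENNReal.ofReal k' * ∫⁻ x in s ∩ t' i, g (f x) ≤ ∫⁻ y, g y * h y := by
    intro i
    obtain ⟨x, hx, hxA⟩ := hA hne i
    obtain ⟨Q, hQ, hQ'⟩ := hr (A i) (hxA ▸ hjac x hx)
    have hsi := hs.inter (hmeas i)
    obtain ⟨hinj, hdet⟩ := hQ' f _ hsi (happ i)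
    have hfi : ∀ x ∈ s ∩ t' i, HasFDerivWithinAt f (f' x) (s ∩ t' i) x :=
      fun x hx => (hf' x hx.1).mono inter_subset_left
    exact lintegral_piece_le j hjm Q hQ hsi hfi hinj (hdet f' hfi)
  choose h hh hhM hint using hpiece
  -- The pieces are disjoint, so their fibre measures add up to at most that of the whole fibre,
  -- which is empty over points outside `t`.
  have hsum : ∀ y, ∑' i, h i y ≤ t.indicator (fun _ => M) y := by
    intro y
    calc ∑' i, h i y
        ≤ ∑' i, (Measure.euclideanHausdorffMeasure (m - n)).restrict (s ∩ f ⁻¹' {y}) (t' i) := by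
          refine ENNReal.tsum_le_tsum fun i => (hhM i y).trans ?_
          rw [Measure.restrict_apply (hmeas i)]
          exact measure_mono fun x hx => ⟨hx.1.2, hx.1.1, hx.2⟩
      _ = (Measure.euclideanHausdorffMeasure (m - n)).restrict (s ∩ f ⁻¹' {y}) (⋃ i, t' i) :=
          (measure_iUnion hdisj hmeas).symm
      _ ≤ Measure.euclideanHausdorffMeasure (m - n) (s ∩ f ⁻¹' {y}) :=
          (measure_mono (subset_univ _)).trans (by simp)
      _ ≤ t.indicator (fun _ => M) y := by
          by_cases hy : y ∈ t
          · simpa [hy] using hM y hy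
          · have : s ∩ f ⁻¹' {y} = ∅ := by
              refine eq_empty_of_forall_notMem fun x hx => hy ?_
              have hxy : f x = y := hx.2
              exact hxy ▸ hst hx.1
            simp [this]
  have hsplit : ∫⁻ x in s, g (f x) = ∑' i, ∫⁻ x in s ∩ t' i, g (f x) := by
    rw [← lintegral_iUnion (fun i => hs.inter (hmeas i))
      (fun i i' hii => (hdisj hii).mono inter_subset_right inter_subset_right), ← inter_iUnion,
      inter_eq_self_of_subset_left hcov]
  calc ENNReal.ofReal k' * ∫⁻ x in s, g (f x)
      = ∑' i, ENNReal.ofReal k' * ∫⁻ x in s ∩ t' i, g (f x) := by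
        rw [hsplit, ENNReal.tsum_mul_left]
    _ ≤ ∑' i, ∫⁻ y, g y * h i y := ENNReal.tsum_le_tsum fun i => hint i g hg
    _ = ∫⁻ y, g y * ∑' i, h i y := by
        simp_rw [← ENNReal.tsum_mul_left]
        exact (lintegral_tsum fun i => (hg.mul (hh i)).aemeasurable).symm
    _ ≤ ∫⁻ y, t.indicator (fun y => M * g y) y := by
        refine lintegral_mono fun y => ?_
        refine (mul_le_mul_right (hsum y) (g y)).trans ?_
        by_cases hy : y ∈ t <;> simp [hy, mul_comm]
    _ = M * ∫⁻ y in t, g y := by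
        rw [lintegral_indicator ht, lintegral_const_mul _ hg]

/-! ### Differentiability, monotonicity and boundary minima on a convex domain -/

open Filter Topology

variable {m n : ℕ} {X : Set (E m)} {Y : Set (E n)}

theorem differentiableAt_of_jac_pos {m n : ℕ} {f : E m → E n} {x : E m}
    (h : 0 < jac (fderiv ℝ f x)) : DifferentiableAt ℝ f x := by
  -- The default derivative `0` has zero Jacobian only for `n > 0`; for `n = 0` the empty
  -- determinant is `1`, but `f` is constant.
  rcases Nat.eq_zero_or_pos n with rfl | hn
  · have : f = fun _ => 0 := funext fun _ => Subsingleton.elim _ _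
    rw [this]
    exact differentiableAt_const _
  · by_contra hd
    have : NeZero n := ⟨hn.ne'⟩
    rw [fderiv_zero_of_not_differentiableAt hd] at h
    simp [jac, ContinuousLinearMap.det] at h

/-- If `f x` were on the boundary, a supporting functional composed with `f` would have a local
maximum at `x`, so it would vanish on the range of the derivative, which is everything. This places
the replies in `Y`, where the fibre bound is available. -/
theorem mem_of_jac_pos {m n : ℕ} {X : Set (E m)} (hX : IsOpen X) {Y : Set (E n)} (hYo : IsOpen Y)
    (hYc : Convex ℝ Y) (hYn : Y.Nonempty) {f : E m → E n} (hf : MapsTo f X (closure Y)) {x : E m}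
    (hx : x ∈ X) (h : 0 < jac (fderiv ℝ f x)) : f x ∈ Y := by
  by_contra hxY
  obtain ⟨l, hl⟩ := geometric_hahn_banach_open_point hYc hYo hxY
  have hle : ∀ y ∈ closure Y, l y ≤ l (f x) := fun y hy =>
    le_on_closure (fun a ha => (hl a ha).le) l.continuous.continuousOn continuousOn_const hy
  have hmax : IsLocalMax (fun x' => l (f x')) x := by
    filter_upwards [hX.mem_nhds hx] with x' hx' using hle _ (hf hx')
  have h0 := hmax.hasFDerivAt_eq_zero
    (l.hasFDerivAt.comp x (differentiableAt_of_jac_pos h).hasFDerivAt)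
  obtain ⟨a, ha⟩ := hYn
  obtain ⟨u, hu⟩ := surjective_of_jac_pos h (a - f x)
  have h1 : l (fderiv ℝ f x u) = 0 := congrArg (fun T => T u) h0
  rw [hu, map_sub] at h1
  linarith [hl a ha]

theorem uniqueDiffOn_closure (hYo : IsOpen Y) (hYc : Convex ℝ Y) (hYn : Y.Nonempty) :
    UniqueDiffOn ℝ (closure Y) :=
  uniqueDiffOn_convex hYc.closure
    (hYn.mono (interior_maximal subset_closure hYo))

theorem inner_grad (f : E n → ℝ) (y v : E n) :
    inner ℝ (grad Y f y) v = fderivWithin ℝ f (closure Y) y v := by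
  simp [grad, gradientWithin]

theorem grad_eq_of_hasFDerivWithinAt (hu : UniqueDiffOn ℝ (closure Y)) {f : E n → ℝ}
    {f' : E n →L[ℝ] ℝ} {y : E n} (hy : y ∈ closure Y) (h : HasFDerivWithinAt f f' (closure Y) y) :
    grad Y f y = (InnerProductSpace.toDual ℝ (E n)).symm f' := by
  rw [grad, gradientWithin, h.fderivWithin (hu y hy)]

theorem continuousOn_grad (hu : UniqueDiffOn ℝ (closure Y)) {f : E n → ℝ}
    (hf : ContDiffOn ℝ 2 f (closure Y)) : ContinuousOn (grad Y f) (closure Y) :=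
  (InnerProductSpace.toDual ℝ (E n)).symm.continuous.comp_continuousOn
    (hf.continuousOn_fderivWithin hu (by norm_num))

/-- Without differentiability `fderivWithin` is `0`, which contradicts a positive lower bound unless
the space is trivial. Hence a Hessian bound carries differentiability of the gradient with it. -/
theorem differentiableAt_of_le_fderivWithin (hYo : IsOpen Y) {g : E n → E n} {a : ℝ} (ha : 0 < a)
    {y : E n} (hy : y ∈ Y)
    (h : ∀ v, a * ‖v‖ ^ 2 ≤ inner ℝ (fderivWithin ℝ g (closure Y) y v) v) :
    HasFDerivAt g (fderivWithin ℝ g (closure Y) y) y := by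
  suffices H : DifferentiableWithinAt ℝ g (closure Y) y from
    H.hasFDerivWithinAt.hasFDerivAt (mem_of_superset (hYo.mem_nhds hy) subset_closure)
  by_contra hd
  have hsub : ∀ v : E n, v = 0 := by
    intro v
    have h0 := h v
    rw [fderivWithin_zero_of_not_differentiableWithinAt hd] at h0
    simp only [zero_apply, inner_zero_left] at h0
    by_contra hv
    have : 0 < a * ‖v‖ ^ 2 := by positivity
    linarith
  have : g = fun _ => 0 := funext fun _ => hsub _
  rw [this] at hd
  exact hd (differentiableWithinAt_const _)

theorem strongly_monotone_interior (hYc : Convex ℝ Y) {g : E n → E n} {a : ℝ}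
    {g' : E n → E n →L[ℝ] E n} (hder : ∀ y ∈ Y, HasFDerivAt g (g' y) y)
    (h : ∀ y ∈ Y, ∀ v, a * ‖v‖ ^ 2 ≤ inner ℝ (g' y v) v)
    {z₁ z₀ : E n} (hz₁ : z₁ ∈ Y) (hz₀ : z₀ ∈ Y) :
    a * ‖z₁ - z₀‖ ^ 2 ≤ inner ℝ (g z₁ - g z₀) (z₁ - z₀) := by
  have hline : ∀ t ∈ Icc (0 : ℝ) 1, z₀ + t • (z₁ - z₀) ∈ Y :=
    fun t ht => hYc.add_smul_sub_mem hz₀ hz₁ ht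
  generalize hv : z₁ - z₀ = v at hline ⊢
  have hφ : ∀ t ∈ Icc (0 : ℝ) 1, HasDerivAt (fun t : ℝ => inner ℝ (g (z₀ + t • v)) v)
      (inner ℝ (g' (z₀ + t • v) v) v) t := by
    intro t ht
    have h1 : HasDerivAt (fun t : ℝ => z₀ + t • v) v t := by
      simpa using ((hasDerivAt_id t).smul_const v).const_add z₀
    have h2 := (hder _ (hline t ht)).comp_hasDerivAt t h1
    simpa using h2.inner ℝ (hasDerivAt_const t v)
  have := (convex_Icc (0 : ℝ) 1).mul_sub_le_image_sub_of_le_deriv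
    (fun t ht => (hφ t ht).continuousAt.continuousWithinAt)
    (fun t ht => (hφ t (interior_subset ht)).differentiableAt.differentiableWithinAt)
    (C := a * ‖v‖ ^ 2)
    (fun t ht => by
      rw [(hφ t (interior_subset ht)).deriv]
      exact h _ (hline t (interior_subset ht)) v)
    0 (by simp) 1 (by simp) zero_le_one
  have hz : z₀ + v = z₁ := by rw [← hv]; abel
  simpa only [sub_zero, mul_one, one_smul, zero_smul, add_zero, hz, ← inner_sub_left] using this

/-- A lower bound on the derivative up to the boundary gives strong monotonicity. -/
theorem strongly_monotone_of_le_fderivWithin (hYo : IsOpen Y) (hYc : Convex ℝ Y)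
    {g : E n → E n} (hg : ContinuousOn g (closure Y)) {a : ℝ} (ha : 0 < a)
    (h : ∀ y ∈ Y, ∀ v, a * ‖v‖ ^ 2 ≤ inner ℝ (fderivWithin ℝ g (closure Y) y v) v)
    {y₁ y₀ : E n} (hy₁ : y₁ ∈ closure Y) (hy₀ : y₀ ∈ closure Y) :
    a * ‖y₁ - y₀‖ ^ 2 ≤ inner ℝ (g y₁ - g y₀) (y₁ - y₀) := by
  have hin : ∀ p ∈ Y ×ˢ Y, a * ‖p.1 - p.2‖ ^ 2 ≤ inner ℝ (g p.1 - g p.2) (p.1 - p.2) :=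
    fun p hp => strongly_monotone_interior hYc
      (fun y hy => differentiableAt_of_le_fderivWithin hYo ha hy (h y hy)) h hp.1 hp.2
  -- Differentiability is only known inside `Y`; boundary points are reached by continuity of both
  -- sides.
  have hmem : (y₁, y₀) ∈ closure (Y ×ˢ Y) := by
    rw [closure_prod_eq]
    exact ⟨hy₁, hy₀⟩
  have hL : ContinuousOn (fun p : E n × E n => a * ‖p.1 - p.2‖ ^ 2) (closure (Y ×ˢ Y)) :=
    (continuous_const.mul ((continuous_fst.sub continuous_snd).norm.pow 2)).continuousOn
  have hR : ContinuousOn (fun p : E n × E n => inner ℝ (g p.1 - g p.2) (p.1 - p.2))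
      (closure (Y ×ˢ Y)) := by
    rw [closure_prod_eq]
    have h1 : ContinuousOn (fun p : E n × E n => g p.1) (closure Y ×ˢ closure Y) :=
      hg.comp continuousOn_fst fun p hp => hp.1
    have h2 : ContinuousOn (fun p : E n × E n => g p.2) (closure Y ×ˢ closure Y) :=
      hg.comp continuousOn_snd fun p hp => hp.2
    exact (h1.sub h2).inner (continuous_fst.sub continuous_snd).continuousOn
  exact ContinuousWithinAt.closure_le hmem ((hL _ hmem).mono subset_closure)
    ((hR _ hmem).mono subset_closure) hin

/-- At a boundary minimum with `G ≠ 0`, the variational inequality makes `-G/|G|` an outward normal,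
and `hout` then yields `-|G| ≥ 0`. -/
theorem gradient_eq_zero_of_isMinOn (hYo : IsOpen Y) (hYc : Convex ℝ Y) {f : E n → ℝ} {y G : E n}
    (hy : y ∈ closure Y) (hG : HasFDerivWithinAt f (InnerProductSpace.toDual ℝ (E n) G) (closure Y) y)
    (hmin : IsMinOn f (closure Y) y)
    (hout : y ∈ frontier Y → ∀ e, IsOutwardUnitNormal Y y e → 0 ≤ inner ℝ G e) : G = 0 := by
  by_cases hyY : y ∈ Y
  · have hnhds : closure Y ∈ 𝓝 y := mem_of_superset (hYo.mem_nhds hyY) subset_closure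
    have := (hmin.isLocalMin hnhds).hasFDerivAt_eq_zero (hG.hasFDerivAt hnhds)
    simpa using this
  · by_contra hne
    have hpos : 0 < ‖G‖ := norm_pos_iff.2 hne
    have hvar : ∀ z ∈ Y, 0 ≤ inner ℝ G (z - y) := by
      intro z hz
      have := hmin.localize.hasFDerivWithinAt_nonneg hG
        (sub_mem_posTangentConeAt_of_segment_subset
          (hYc.closure.segment_subset hy (subset_closure hz)))
      simpa using this
    have h1 := hout (by rw [hYo.frontier_eq]; exact ⟨hy, hyY⟩) (-(‖G‖⁻¹ • G)) ⟨by
        rw [norm_neg, norm_smul, norm_inv, norm_norm, inv_mul_cancel₀ hpos.ne'], fun z hz => by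
        rw [inner_neg_left, inner_smul_left]
        have := hvar z hz
        simp only [conj_trivial, Left.neg_nonpos_iff]
        positivity⟩
    rw [inner_neg_right, inner_smul_right, real_inner_self_eq_norm_sq] at h1
    have : 0 < ‖G‖⁻¹ * ‖G‖ ^ 2 := by positivity
    linarith

/-! ### Differentiating the interaction integral up to the boundary -/

theorem hasFDerivWithinAt_slice {W : E n → E n → ℝ} {S : Set (E n)}
    (hW : ContDiffOn ℝ 2 (fun p : E n × E n => W p.1 p.2) (S ×ˢ S)) {y z : E n} (hy : y ∈ S)
    (hz : z ∈ S) :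
    HasFDerivWithinAt (fun y' => W y' z)
      ((fderivWithin ℝ (fun p : E n × E n => W p.1 p.2) (S ×ˢ S) (y, z)).comp
        (ContinuousLinearMap.inl ℝ (E n) (E n))) S y := by
  have h1 := (hW.differentiableOn (by norm_num) (y, z) (mk_mem_prod hy hz)).hasFDerivWithinAt
  have h2 : HasFDerivWithinAt (fun y' : E n => (y', z)) (ContinuousLinearMap.inl ℝ (E n) (E n))
      S y := (hasFDerivWithinAt_id y S).prodMk (hasFDerivWithinAt_const z y S)
  have h3 : MapsTo (fun y' : E n => (y', z)) S (S ×ˢ S) := fun y' hy' => ⟨hy', hz⟩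
  exact h1.comp y h2 h3

theorem fderivWithin_slice {W : E n → E n → ℝ} {S : Set (E n)} (hS : UniqueDiffOn ℝ S)
    (hW : ContDiffOn ℝ 2 (fun p : E n × E n => W p.1 p.2) (S ×ˢ S)) {y z : E n} (hy : y ∈ S)
    (hz : z ∈ S) :
    fderivWithin ℝ (fun y' => W y' z) S y =
      (fderivWithin ℝ (fun p : E n × E n => W p.1 p.2) (S ×ˢ S) (y, z)).comp
        (ContinuousLinearMap.inl ℝ (E n) (E n)) :=
  (hasFDerivWithinAt_slice hW hy hz).fderivWithin (hS y hy)

theorem continuousOn_fderivWithin_slice {W : E n → E n → ℝ} {S : Set (E n)}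
    (hS : UniqueDiffOn ℝ S) (hW : ContDiffOn ℝ 2 (fun p : E n × E n => W p.1 p.2) (S ×ˢ S)) :
    ContinuousOn (fun p : E n × E n => fderivWithin ℝ (fun y' => W y' p.2) S p.1) (S ×ˢ S) := by
  refine ContinuousOn.congr (f := fun p : E n × E n =>
      (fderivWithin ℝ (fun p : E n × E n => W p.1 p.2) (S ×ˢ S) p).comp
        (ContinuousLinearMap.inl ℝ (E n) (E n))) ?_ fun p hp => fderivWithin_slice hS hW hp.1 hp.2
  exact (hW.continuousOn_fderivWithin (hS.prod hS) (by norm_num)).clm_comp continuousOn_const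

theorem restrict_eq_of_compl_null {α : Type*} [MeasurableSpace α] {ν : Measure α} {S : Set α}
    (h : ν Sᶜ = 0) : ν.restrict S = ν := Measure.restrict_eq_self_of_ae_mem (by
  rw [ae_iff]; exact h)

theorem integrable_of_continuousOn_compact {α G : Type*} [TopologicalSpace α] [MeasurableSpace α]
    [BorelSpace α] [T2Space α] [NormedAddCommGroup G] [SecondCountableTopology G] {ν : Measure α}
    [IsFiniteMeasure ν] {S : Set α} (hS : IsCompact S) (h : ν Sᶜ = 0)
    {f : α → G} (hf : ContinuousOn f S) : Integrable f ν := by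
  have := hf.integrableOn_compact (μ := ν) hS
  rwa [IntegrableOn, restrict_eq_of_compl_null h] at this

/-- Uniform continuity of the partial derivative on the compact `S ×ˢ S`, with the mean value
inequality on the convex set `S ∩ ball y δ`, bounds the first-order remainder uniformly in `z`, so
it survives integration. -/
theorem hasFDerivWithinAt_integral {W : E n → E n → ℝ} {S : Set (E n)} (hS : UniqueDiffOn ℝ S)
    (hSc : IsCompact S) (hSv : Convex ℝ S)
    (hW : ContDiffOn ℝ 2 (fun p : E n × E n => W p.1 p.2) (S ×ˢ S)) {ν : Measure (E n)}
    [IsProbabilityMeasure ν] (hν : ν Sᶜ = 0) {y : E n} (hy : y ∈ S) :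
    HasFDerivWithinAt (fun y => ∫ z, W y z ∂ν)
      (∫ z, fderivWithin ℝ (fun y' => W y' z) S y ∂ν) S y := by
  set D : E n → E n → (E n →L[ℝ] ℝ) := fun y z => fderivWithin ℝ (fun y' => W y' z) S y with hD
  have hDc : ContinuousOn (fun p : E n × E n => D p.1 p.2) (S ×ˢ S) :=
    continuousOn_fderivWithin_slice hS hW
  have hslice : ∀ {y}, y ∈ S → MapsTo (fun z => (y, z)) S (S ×ˢ S) := fun hy z hz => ⟨hy, hz⟩
  have hWi : ∀ y ∈ S, Integrable (fun z => W y z) ν := fun y hy =>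
    integrable_of_continuousOn_compact hSc hν
      (hW.continuousOn.comp (by fun_prop) (hslice hy))
  have hDi : Integrable (fun z => D y z) ν :=
    integrable_of_continuousOn_compact hSc hν (hDc.comp (by fun_prop) (hslice hy))
  have huc := (hSc.prod hSc).uniformContinuousOn_of_continuous hDc
  rw [Metric.uniformContinuousOn_iff] at huc
  refine HasFDerivWithinAt.of_isLittleO (Asymptotics.isLittleO_iff.2 fun ε hε => ?_)
  obtain ⟨δ, hδ, hD'⟩ := huc ε hε
  filter_upwards [inter_mem_nhdsWithin S (Metric.ball_mem_nhds y hδ)] with y' hy'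
  have hpt : ∀ z ∈ S, ‖W y' z - W y z - D y z (y' - y)‖ ≤ ε * ‖y' - y‖ := by
    intro z hz
    refine (hSv.inter (convex_ball y δ)).norm_image_sub_le_of_norm_hasFDerivWithin_le'
      (f := fun y => W y z) (f' := fun y => D y z) (φ := D y z) (fun x hx => ?_) (fun x hx => ?_)
      ⟨hy, Metric.mem_ball_self hδ⟩ hy'
    · have := hasFDerivWithinAt_slice hW hx.1 hz
      rw [← fderivWithin_slice hS hW hx.1 hz] at this
      exact this.mono inter_subset_left
    · rw [← dist_eq_norm]
      refine (hD' (x, z) ⟨hx.1, hz⟩ (y, z) ⟨hy, hz⟩ ?_).le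
      simpa [Prod.dist_eq] using hx.2
  have heq : (∫ z, W y' z ∂ν) - (∫ z, W y z ∂ν) - (∫ z, D y z ∂ν) (y' - y) =
      ∫ z, (W y' z - W y z - D y z (y' - y)) ∂ν := by
    have hsub : Integrable (fun z => W y' z - W y z) ν := (hWi y' hy'.1).sub (hWi y hy)
    rw [integral_sub hsub (hDi.apply_continuousLinearMap _),
      integral_sub (hWi y' hy'.1) (hWi y hy), ContinuousLinearMap.integral_apply hDi]
  rw [heq]
  have hae : ∀ᵐ z ∂ν, ‖W y' z - W y z - D y z (y' - y)‖ ≤ ε * ‖y' - y‖ := by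
    have hmem : ∀ᵐ z ∂ν, z ∈ S := by rw [ae_iff]; exact hν
    filter_upwards [hmem] with z hz using hpt z hz
  simpa using norm_integral_le_of_norm_le_const hae

theorem continuousOn_integral_fderivWithin {W : E n → E n → ℝ} {S : Set (E n)}
    (hS : UniqueDiffOn ℝ S) (hSc : IsCompact S)
    (hW : ContDiffOn ℝ 2 (fun p : E n × E n => W p.1 p.2) (S ×ˢ S)) {ν : Measure (E n)}
    [IsProbabilityMeasure ν] (hν : ν Sᶜ = 0) :
    ContinuousOn (fun y => ∫ z, fderivWithin ℝ (fun y' => W y' z) S y ∂ν) S := by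
  have hDc := continuousOn_fderivWithin_slice hS hW
  have hmem : ∀ᵐ z ∂ν, z ∈ S := by rw [ae_iff]; exact hν
  obtain ⟨K, hK⟩ := (hSc.prod hSc).exists_bound_of_continuousOn hDc
  refine continuousOn_of_dominated (bound := fun _ => K) (fun y hy => ?_) (fun y hy => ?_)
    (integrable_const _) ?_
  · exact (integrable_of_continuousOn_compact hSc hν
      (hDc.comp (f := fun z => (y, z)) (by fun_prop) fun z hz => ⟨hy, hz⟩)).aestronglyMeasurable
  · filter_upwards [hmem] with z hz using hK (y, z) ⟨hy, hz⟩
  · filter_upwards [hmem] with z hz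
    exact hDc.comp (f := fun y => (y, z)) (by fun_prop) fun y hy => ⟨hy, hz⟩

section FirstVariation

variable (hYo : IsOpen Y) (hYb : Bornology.IsBounded Y) (hYc : Convex ℝ Y) (hYn : Y.Nonempty)
  {V : E n → ℝ} (hV : ContDiffOn ℝ 2 V (closure Y)) {W : E n → E n → ℝ}
  (hW : ContDiffOn ℝ 2 (fun p : E n × E n => W p.1 p.2) (closure Y ×ˢ closure Y))
  {ν : Measure (E n)} (hν : ν ∈ probOn (closure Y))
include hYo hYb hYc hYn hV hW hν

theorem hasFDerivWithinAt_firstVar {y : E n} (hy : y ∈ closure Y) :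
    HasFDerivWithinAt (firstVar V W ν) (fderivWithin ℝ V (closure Y) y +
      ∫ z, fderivWithin ℝ (fun y' => W y' z) (closure Y) y ∂ν) (closure Y) y := by
  have := hν.1
  exact ((hV.differentiableOn (by norm_num)) y hy).hasFDerivWithinAt.add
    (hasFDerivWithinAt_integral (uniqueDiffOn_closure hYo hYc hYn) hYb.isCompact_closure
      hYc.closure hW hν.2 hy)

theorem continuousOn_grad_firstVar : ContinuousOn (grad Y (firstVar V W ν)) (closure Y) := by
  have := hν.1
  have hu := uniqueDiffOn_closure hYo hYc hYn
  refine ContinuousOn.congr (f := fun y => (InnerProductSpace.toDual ℝ (E n)).symm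
    (fderivWithin ℝ V (closure Y) y +
      ∫ z, fderivWithin ℝ (fun y' => W y' z) (closure Y) y ∂ν)) ?_ fun y hy =>
    grad_eq_of_hasFDerivWithinAt hu hy (hasFDerivWithinAt_firstVar hYo hYb hYc hYn hV hW hν hy)
  exact (InnerProductSpace.toDual ℝ (E n)).symm.continuous.comp_continuousOn
    ((hV.continuousOn_fderivWithin hu (by norm_num)).add
      (continuousOn_integral_fderivWithin hu hYb.isCompact_closure hW hν.2))

theorem inner_grad_firstVar {y : E n} (hy : y ∈ closure Y) (v : E n) :
    inner ℝ (grad Y (firstVar V W ν) y) v =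
      inner ℝ (grad Y V y) v + ∫ z, inner ℝ (grad Y (fun y' => W y' z) y) v ∂ν := by
  have := hν.1
  have hu := uniqueDiffOn_closure hYo hYc hYn
  simp only [inner_grad]
  rw [(hasFDerivWithinAt_firstVar hYo hYb hYc hYn hV hW hν hy).fderivWithin (hu y hy),
    add_apply, ContinuousLinearMap.integral_apply]
  exact integrable_of_continuousOn_compact hYb.isCompact_closure hν.2
    ((continuousOn_fderivWithin_slice hu hW).comp (f := fun z => (y, z)) (by fun_prop)
      fun z hz => ⟨hy, hz⟩)

end FirstVariation

/-! ### Existence, uniqueness and stability of the reply -/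

section Reply

variable (hYo : IsOpen Y) (hYb : Bornology.IsBounded Y) (hYc : Convex ℝ Y) (hYn : Y.Nonempty)
  {V : E n → ℝ} (hV : ContDiffOn ℝ 2 V (closure Y)) {W : E n → E n → ℝ}
  (hW : ContDiffOn ℝ 2 (fun p : E n × E n => W p.1 p.2) (closure Y ×ˢ closure Y))
  {ν : Measure (E n)} (hν : ν ∈ probOn (closure Y))
include hYo hYb hYc hYn hV hW hν

/-- Average the inequality in `z` against `ν`. As `ν` may charge the boundary, it is first extended
to `closure Y` by continuity. -/
theorem inner_grad_add_grad_firstVar_nonneg {G : E n} {y e : E n} (hy : y ∈ closure Y)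
    (h : ∀ z ∈ Y, 0 ≤ inner ℝ (G + grad Y V y + grad Y (fun y' => W y' z) y) e) :
    0 ≤ inner ℝ (G + grad Y (firstVar V W ν) y) e := by
  have := hν.1
  have hu := uniqueDiffOn_closure hYo hYc hYn
  have hcont : ContinuousOn (fun z => inner ℝ (grad Y (fun y' => W y' z) y) e) (closure Y) := by
    simp only [inner_grad]
    exact ((continuousOn_fderivWithin_slice hu hW).comp (f := fun z => (y, z)) (by fun_prop)
      fun z hz => ⟨hy, hz⟩).clm_apply continuousOn_const
  have hcl : ∀ z ∈ closure Y, -(inner ℝ G e + inner ℝ (grad Y V y) e) ≤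
      inner ℝ (grad Y (fun y' => W y' z) y) e := by
    intro z hz
    refine ContinuousWithinAt.closure_le hz continuousWithinAt_const
      ((hcont z hz).mono subset_closure) fun z' hz' => ?_
    have := h z' hz'
    rw [inner_add_left, inner_add_left] at this
    linarith
  have hint := integrable_of_continuousOn_compact hYb.isCompact_closure hν.2 hcont
  have hle : -(inner ℝ G e + inner ℝ (grad Y V y) e) ≤
      ∫ z, inner ℝ (grad Y (fun y' => W y' z) y) e ∂ν := by
    have hae : ∀ᵐ z ∂ν, z ∈ closure Y := by rw [ae_iff]; exact hν.2
    have := integral_mono_ae (integrable_const _) hint (hae.mono hcl)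
    simpa using this
  rw [inner_add_left, inner_grad_firstVar hYo hYb hYc hYn hV hW hν hy]
  linarith

variable {c : E m → E n → ℝ} {x : E m} (hcx : ContDiffOn ℝ 2 (c x) (closure Y))
include hcx

theorem isReply_of_isMinOn
    (hout : ∀ z ∈ Y, ∀ y ∈ frontier Y, ∀ e, IsOutwardUnitNormal Y y e →
      0 ≤ inner ℝ (grad Y (c x) y + grad Y V y + grad Y (fun y' => W y' z) y) e)
    {y : E n} (hy : y ∈ closure Y)
    (hmin : IsMinOn (fun y => c x y + firstVar V W ν y) (closure Y) y) :
    IsReply Y c V W ν x y := by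
  have hu := uniqueDiffOn_closure hYo hYc hYn
  refine ⟨hy, gradient_eq_zero_of_isMinOn hYo hYc hy ?_ hmin fun hyf e he =>
    inner_grad_add_grad_firstVar_nonneg hYo hYb hYc hYn hV hW hν hy fun z hz =>
      hout z hz y hyf e he⟩
  have h1 := ((hcx.differentiableOn (by norm_num)) y hy).hasFDerivWithinAt
  have h2 := (hasFDerivWithinAt_firstVar hYo hYb hYc hYn hV hW hν
    hy).differentiableWithinAt.hasFDerivWithinAt
  have hG : InnerProductSpace.toDual ℝ (E n) (grad Y (c x) y + grad Y (firstVar V W ν) y) =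
      fderivWithin ℝ (c x) (closure Y) y + fderivWithin ℝ (firstVar V W ν) (closure Y) y := by
    simp [grad, gradientWithin]
  rw [hG]
  exact h1.add h2

variable {η lam : ℝ} (hη : 0 < η)
    (hcη : ∀ y ∈ Y, ∀ v, η * ‖v‖ ^ 2 ≤ hess Y (c x) y v) (hlam : 0 < lam)
    (hFlam : ∀ y ∈ Y, ∀ v, lam * ‖v‖ ^ 2 ≤ hess Y (firstVar V W ν) y v)
include hη hcη hlam hFlam

/-- Add the strong monotonicity of both gradients: criticality of `y₁` and `y₀` leaves only the
change of `DF` at `y₀`, and Cauchy–Schwarz concludes. Since the right side sees only `y₀`, the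
coarea inequality will be needed for one reply map alone. -/
theorem norm_sub_le_of_isReply {ν₀ : Measure (E n)} {y₁ y₀ : E n}
    (h₁ : IsReply Y c V W ν x y₁) (h₀ : IsReply Y c V W ν₀ x y₀) :
    (η + lam) * ‖y₁ - y₀‖ ≤ ‖grad Y (firstVar V W ν) y₀ - grad Y (firstVar V W ν₀) y₀‖ := by
  have hu := uniqueDiffOn_closure hYo hYc hYn
  have m1 := strongly_monotone_of_le_fderivWithin hYo hYc (continuousOn_grad hu hcx) hη hcη h₁.1 h₀.1
  have m2 := strongly_monotone_of_le_fderivWithin hYo hYc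
    (continuousOn_grad_firstVar hYo hYb hYc hYn hV hW hν) hlam hFlam h₁.1 h₀.1
  rcases eq_or_ne (y₁ - y₀) 0 with hd | hd
  · rw [hd]
    simp
  have hpos : 0 < ‖y₁ - y₀‖ := norm_pos_iff.2 hd
  have hsum : (grad Y (c x) y₁ - grad Y (c x) y₀) +
      (grad Y (firstVar V W ν) y₁ - grad Y (firstVar V W ν) y₀) =
      -(grad Y (firstVar V W ν) y₀ - grad Y (firstVar V W ν₀) y₀) := by
    rw [eq_neg_of_add_eq_zero_left h₁.2, eq_neg_of_add_eq_zero_left h₀.2]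
    abel
  have h3 := real_inner_le_norm (-(grad Y (firstVar V W ν) y₀ - grad Y (firstVar V W ν₀) y₀))
    (y₁ - y₀)
  rw [← hsum, inner_add_left, hsum, norm_neg] at h3
  refine le_of_mul_le_mul_right ?_ hpos
  nlinarith

theorem existsUnique_isReply
    (hout : ∀ z ∈ Y, ∀ y ∈ frontier Y, ∀ e, IsOutwardUnitNormal Y y e →
      0 ≤ inner ℝ (grad Y (c x) y + grad Y V y + grad Y (fun y' => W y' z) y) e) :
    ∃! y, IsReply Y c V W ν x y := by
  have hcont : ContinuousOn (fun y => c x y + firstVar V W ν y) (closure Y) :=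
    hcx.continuousOn.add fun y hy =>
      (hasFDerivWithinAt_firstVar hYo hYb hYc hYn hV hW hν hy).continuousWithinAt
  obtain ⟨y, hy, hmin⟩ := hYb.isCompact_closure.exists_isMinOn hYn.closure hcont
  have hr := isReply_of_isMinOn hYo hYb hYc hYn hV hW hν hcx hout hy hmin
  refine ⟨y, hr, fun y' hy' => ?_⟩
  have := norm_sub_le_of_isReply hYo hYb hYc hYn hV hW hν hcx hη hcη hlam hFlam hy' hr
  rw [sub_self, norm_zero] at this
  have h0 : ‖y' - y‖ ≤ 0 := by
    by_contra! hpos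
    have : 0 < (η + lam) * ‖y' - y‖ := by positivity
    linarith
  exact sub_eq_zero.1 (norm_le_zero_iff.1 h0)

end Reply

/-! ### Push-forwards, transport plans and the contraction estimate -/

theorem reply_spec {c : E m → E n → ℝ} {V : E n → ℝ} {W : E n → E n → ℝ} {ν : Measure (E n)}
    {x : E m} (h : ∃ y, IsReply Y c V W ν x y) : IsReply Y c V W ν x (reply Y c V W ν x) := by
  rw [reply, dif_pos h]
  exact h.choose_spec

theorem contDiffOn_slice {c : E m → E n → ℝ} {S : Set (E n)}
    (hc : ContDiffOn ℝ 2 (fun p : E m × E n => c p.1 p.2) (X ×ˢ S)) {x : E m} (hx : x ∈ X) :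
    ContDiffOn ℝ 2 (c x) S :=
  hc.comp (f := fun y => (x, y)) (by fun_prop) fun y hy => ⟨hx, hy⟩

theorem aemeasurable_reply (hXo : IsOpen X) {μ : Measure (E m)} (hμ : μ ∈ probOn X)
    {f : E m → E n} (hf : ∀ x ∈ X, 0 < jac (fderiv ℝ f x)) : AEMeasurable f μ := by
  have hcont : ContinuousOn f X := fun x hx =>
    (differentiableAt_of_jac_pos (hf x hx)).continuousAt.continuousWithinAt
  have := hcont.aemeasurable (μ := μ) hXo.measurableSet
  rwa [restrict_eq_of_compl_null hμ.2] at this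

theorem map_mem_probOn {S : Set (E n)} (hS : MeasurableSet S) {μ : Measure (E m)}
    (hμ : μ ∈ probOn X) {f : E m → E n} (hf : AEMeasurable f μ) (hmaps : MapsTo f X S) :
    μ.map f ∈ probOn S := by
  have := hμ.1
  refine ⟨Measure.isProbabilityMeasure_map hf, ?_⟩
  rw [Measure.map_apply_of_aemeasurable hf hS.compl]
  exact measure_mono_null (fun x hx hxX => hx (hmaps hxX)) hμ.2

theorem map_prodMk_mem_plans {a b : ℕ} {μ : Measure (E m)} {f : E m → E a} {g : E m → E b}
    (hf : AEMeasurable f μ) (hg : AEMeasurable g μ) :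
    μ.map (fun x => (f x, g x)) ∈ plans (μ.map f) (μ.map g) := by
  constructor
  · rw [AEMeasurable.map_map_of_aemeasurable measurable_fst.aemeasurable (hf.prodMk hg)]
    rfl
  · rw [AEMeasurable.map_map_of_aemeasurable measurable_snd.aemeasurable (hf.prodMk hg)]
    rfl

theorem W1_map_le {μ : Measure (E m)} {f g : E m → E n} (hf : AEMeasurable f μ)
    (hg : AEMeasurable g μ) : W1 (μ.map f) (μ.map g) ≤ ∫⁻ x, edist (f x) (g x) ∂μ := by
  refine (iInf₂_le (μ.map fun x => (f x, g x)) (map_prodMk_mem_plans hf hg)).trans ?_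
  rw [lintegral_map' (measurable_fst.edist measurable_snd).aemeasurable (hf.prodMk hg)]

theorem prod_mem_plans {μ : Measure (E m)} {ν : Measure (E n)} [IsProbabilityMeasure μ]
    [IsProbabilityMeasure ν] : μ.prod ν ∈ plans μ ν := by
  constructor
  · rw [Measure.map_fst_prod]; simp
  · rw [Measure.map_snd_prod]; simp

theorem ae_mem_of_mem_plans {μ : Measure (E m)} {ν : Measure (E n)} {S : Set (E n)}
    (hμ : μ ∈ probOn X) (hν : ν ∈ probOn S)
    {γ : Measure (E m × E n)} (hγ : γ ∈ plans μ ν) : ∀ᵐ p ∂γ, p ∈ X ×ˢ S := by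
  have h1 : ∀ᵐ x ∂γ.map Prod.fst, x ∈ X := by rw [hγ.1, ae_iff]; exact hμ.2
  have h2 : ∀ᵐ x ∂γ.map Prod.snd, x ∈ S := by rw [hγ.2, ae_iff]; exact hν.2
  filter_upwards [ae_of_ae_map measurable_fst.aemeasurable h1,
    ae_of_ae_map measurable_snd.aemeasurable h2] with p hp1 hp2 using ⟨hp1, hp2⟩

theorem W1_lt_top {S : Set (E n)} (hb : Bornology.IsBounded S)
    {ν₁ ν₀ : Measure (E n)} (h₁ : ν₁ ∈ probOn S) (h₀ : ν₀ ∈ probOn S) : W1 ν₁ ν₀ < ∞ := by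
  have := h₁.1
  have := h₀.1
  refine (iInf₂_le (ν₁.prod ν₀) prod_mem_plans).trans_lt ?_
  refine (lintegral_mono_ae (g := fun _ => Metric.ediam S) ?_).trans_lt ?_
  · filter_upwards [ae_mem_of_mem_plans h₁ h₀ prod_mem_plans] with p hp using
      Metric.edist_le_ediam_of_mem hp.1 hp.2
  · simpa using hb.ediam_ne_top.lt_top

theorem le_essSup_smul_restrict {α : Type*} [MeasurableSpace α] {μ vol : Measure α}
    [SigmaFinite vol] [SigmaFinite μ] (h : μ ≪ vol) {X : Set α} (hX : MeasurableSet X)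
    (hμ : μ Xᶜ = 0) : μ ≤ essSup (μ.rnDeriv vol) vol • vol.restrict X := by
  refine Measure.le_iff.2 fun A hA => ?_
  calc μ A = μ (A ∩ X) := by
        conv_lhs => rw [← restrict_eq_of_compl_null hμ, Measure.restrict_apply hA]
    _ = ∫⁻ x in A ∩ X, μ.rnDeriv vol x ∂vol := by
        conv_lhs => rw [← Measure.withDensity_rnDeriv_eq μ vol h,
          withDensity_apply _ (hA.inter hX)]
    _ ≤ ∫⁻ _ in A ∩ X, essSup (μ.rnDeriv vol) vol ∂vol :=
        lintegral_mono_ae (ae_restrict_of_ae (ENNReal.ae_le_essSup _))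
    _ = _ := by
        rw [setLIntegral_const, Measure.smul_apply, Measure.restrict_apply hA, smul_eq_mul]

theorem mul_lintegral_edist_le (hnm : n ≤ m) (hXo : IsOpen X) (hYo : IsOpen Y)
    {μ : Measure (E m)} (hμ : μ ∈ probOn X) (hμac : μ ≪ volume) {f₁ f₀ : E m → E n} {k a : ℝ}
    (hk : 0 < k) (hf₀ : MapsTo f₀ X Y) (hjac : ∀ x ∈ X, k ≤ jac (fderiv ℝ f₀ x)) {M : ℝ≥0∞}
    (hM : ∀ y ∈ Y, Measure.euclideanHausdorffMeasure (m - n) {x ∈ X | f₀ x = y} ≤ M)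
    {G : E n → E n} (hG : ContinuousOn G Y) (ha : 0 < a)
    (hle : ∀ x ∈ X, a * ‖f₁ x - f₀ x‖ ≤ ‖G (f₀ x)‖) :
    ENNReal.ofReal (k * a) * ∫⁻ x, edist (f₁ x) (f₀ x) ∂μ ≤
      essSup (μ.rnDeriv volume) volume * M * ∫⁻ y in Y, ‖G y‖ₑ := by
  have := hμ.1
  -- `G` is controlled only on `Y`; extension by zero gives the globally measurable integrand that
  -- the coarea inequality takes.
  set g : E n → ℝ≥0∞ := Y.indicator fun y => ‖G y‖ₑ with hg
  have hgm : Measurable g := by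
    have h0 : ContinuousOn (fun y => ‖G y‖ₑ) Y := hG.enorm
    classical
    have := ContinuousOn.measurable_piecewise (g := 0) h0 continuousOn_const hYo.measurableSet
    rwa [Set.piecewise_eq_indicator] at this
  have hcoarea := mul_lintegral_comp_le_of_le_jac hnm hXo.measurableSet
    (fun x hx => (differentiableAt_of_jac_pos (hk.trans_le (hjac x hx))).hasFDerivAt.hasFDerivWithinAt)
    hk hjac hYo.measurableSet hf₀ hM hgm
  have hgY : ∫⁻ y in Y, g y = ∫⁻ y in Y, ‖G y‖ₑ :=
    setLIntegral_congr_fun hYo.measurableSet fun y hy => by simp [hg, hy]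
  have hae : ∀ᵐ x ∂μ, x ∈ X := by rw [ae_iff]; exact hμ.2
  have h1 : ENNReal.ofReal a * ∫⁻ x, edist (f₁ x) (f₀ x) ∂μ ≤ ∫⁻ x, g (f₀ x) ∂μ := by
    rw [← lintegral_const_mul' _ _ ENNReal.ofReal_ne_top]
    refine lintegral_mono_ae (hae.mono fun x hx => ?_)
    simp only [hg, indicator_of_mem (hf₀ hx)]
    rw [edist_dist, dist_eq_norm, ← ENNReal.ofReal_mul ha.le, ← ofReal_norm]
    exact ENNReal.ofReal_le_ofReal (hle x hx)
  have h2 : ∫⁻ x, g (f₀ x) ∂μ ≤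
      essSup (μ.rnDeriv volume) volume * ∫⁻ x in X, g (f₀ x) := by
    rw [← smul_eq_mul, ← lintegral_smul_measure]
    exact lintegral_mono' (le_essSup_smul_restrict hμac hXo.measurableSet hμ.2) le_rfl
  calc ENNReal.ofReal (k * a) * ∫⁻ x, edist (f₁ x) (f₀ x) ∂μ
      = ENNReal.ofReal k * (ENNReal.ofReal a * ∫⁻ x, edist (f₁ x) (f₀ x) ∂μ) := by
        rw [ENNReal.ofReal_mul hk.le, mul_assoc]
    _ ≤ ENNReal.ofReal k * (essSup (μ.rnDeriv volume) volume * ∫⁻ x in X, g (f₀ x)) := by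
        exact mul_le_mul_right (h1.trans h2) _
    _ = essSup (μ.rnDeriv volume) volume * (ENNReal.ofReal k * ∫⁻ x in X, g (f₀ x)) := by ring
    _ ≤ essSup (μ.rnDeriv volume) volume * (M * ∫⁻ y in Y, g y) := by gcongr
    _ = _ := by rw [hgY, mul_assoc]

/-! ### Minimizing a quadratic functional over plans -/

/-- Probability measures on a compact space are weakly compact, the marginal constraint is closed,
and the quadratic term is continuous because `γ ↦ γ ⊗ γ` is. The work is done on the subtype `K` and
transported back. -/
theorem exists_minimizer_of_compact {α β : Type*} [MetricSpace α] [SecondCountableTopology α]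
    [MeasurableSpace α] [BorelSpace α] [MetricSpace β] [SecondCountableTopology β]
    [MeasurableSpace β] [BorelSpace β] {K : Set α} (hK : IsCompact K) {π : α → β}
    (hπ : Continuous π) {μ : Measure β} [IsProbabilityMeasure μ] {f : α → ℝ}
    (hf : ContinuousOn f K) {H : α × α → ℝ} (hH : ContinuousOn H (K ×ˢ K))
    (hne : ∃ γ : Measure α, IsProbabilityMeasure γ ∧ γ Kᶜ = 0 ∧ γ.map π = μ) :
    ∃ γ : Measure α, (IsProbabilityMeasure γ ∧ γ Kᶜ = 0 ∧ γ.map π = μ) ∧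
      ∀ γ' : Measure α, IsProbabilityMeasure γ' ∧ γ' Kᶜ = 0 ∧ γ'.map π = μ →
        (∫ p, f p ∂γ) + ∫ p, H p ∂γ.prod γ ≤ (∫ p, f p ∂γ') + ∫ p, H p ∂γ'.prod γ' := by
  have : CompactSpace K := isCompact_iff_compactSpace.1 hK
  have hemb : MeasurableEmbedding (Subtype.val : K → α) :=
    MeasurableEmbedding.subtype_coe hK.measurableSet
  let fK : BoundedContinuousFunction K ℝ :=
    BoundedContinuousFunction.mkOfCompact ⟨K.domRestrict f, hf.domRestrict⟩
  let HK : BoundedContinuousFunction (K × K) ℝ :=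
    BoundedContinuousFunction.mkOfCompact ⟨fun p => H (p.1, p.2),
      hH.comp_continuous (by fun_prop) fun p => ⟨p.1.2, p.2.2⟩⟩
  let J : ProbabilityMeasure K → ℝ := fun γ => (∫ p, fK p ∂γ) + ∫ p, HK p ∂(γ.prod γ)
  have hJ : Continuous J :=
    (ProbabilityMeasure.continuous_integral_boundedContinuousFunction fK).add
      ((ProbabilityMeasure.continuous_integral_boundedContinuousFunction HK).comp
        (ProbabilityMeasure.continuous_prod.comp (continuous_id.prodMk continuous_id)))
  have hπK : Continuous fun p : K => π p := hπ.comp continuous_subtype_val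
  let T : Set (ProbabilityMeasure K) := {γ | γ.map hπK.aemeasurable = ⟨μ, inferInstance⟩}
  have hT : IsClosed T := isClosed_eq (ProbabilityMeasure.continuous_map hπK) continuous_const
  have hpull : ∀ γ : Measure α, IsProbabilityMeasure γ ∧ γ Kᶜ = 0 ∧ γ.map π = μ →
      ∃ γK ∈ T, (γK : Measure K).map Subtype.val = γ := by
    rintro γ ⟨h1, h2, h3⟩
    have hmap : (γ.comap Subtype.val : Measure K).map Subtype.val = γ := by
      rw [map_comap_subtype_coe hK.measurableSet, restrict_eq_of_compl_null h2]
    have hp : IsProbabilityMeasure (γ.comap Subtype.val : Measure K) := by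
      refine ⟨?_⟩
      rw [← preimage_univ (f := (Subtype.val : K → α)),
        ← Measure.map_apply measurable_subtype_coe MeasurableSet.univ, hmap, measure_univ]
    refine ⟨⟨γ.comap Subtype.val, hp⟩, ?_, hmap⟩
    apply Subtype.ext
    change (γ.comap Subtype.val : Measure K).map (fun p : K => π p) = μ
    rw [← h3]
    conv_rhs => rw [← hmap]
    rw [Measure.map_map hπ.measurable measurable_subtype_coe]
    rfl
  have hval : ∀ γ : ProbabilityMeasure K, J γ =
      (∫ p, f p ∂((γ : Measure K).map Subtype.val)) +
        ∫ p, H p ∂((γ : Measure K).map Subtype.val).prod ((γ : Measure K).map Subtype.val) := by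
    intro γ
    rw [Measure.map_prod_map _ _ measurable_subtype_coe measurable_subtype_coe,
      (hemb.prodMap hemb).integral_map, hemb.integral_map]
    rfl
  obtain ⟨γ₀, hγ₀⟩ := hne
  obtain ⟨γ₁, hγ₁, -⟩ := hpull γ₀ hγ₀
  obtain ⟨γ, hγ, hmin⟩ := hT.isCompact.exists_isMinOn ⟨γ₁, hγ₁⟩ hJ.continuousOn
  refine ⟨(γ : Measure K).map Subtype.val, ⟨?_, ?_, ?_⟩, fun γ' hγ' => ?_⟩
  · exact Measure.isProbabilityMeasure_map measurable_subtype_coe.aemeasurable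
  · rw [Measure.map_apply measurable_subtype_coe hK.measurableSet.compl]
    simp
  · rw [Measure.map_map hπ.measurable measurable_subtype_coe]
    exact congrArg Subtype.val hγ
  · obtain ⟨γK, hγK, rfl⟩ := hpull γ' hγ'
    rw [← hval, ← hval]
    exact hmin hγK

theorem prod_compl_null {α β : Type*} [MeasurableSpace α] [MeasurableSpace β] {μ : Measure α}
    {ν : Measure β} [SFinite μ] [SFinite ν] {S : Set α} {T : Set β} (hμ : μ Sᶜ = 0)
    (hν : ν Tᶜ = 0) : (μ.prod ν) (S ×ˢ T)ᶜ = 0 := by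
  rw [compl_prod_eq_union]
  exact measure_union_null (by rw [Measure.prod_prod, hμ, zero_mul])
    (by rw [Measure.prod_prod, hν, mul_zero])

/-- Compare with `(1 - t)γ + tγ'`, expand, divide by `t` and let `t` tend to `0`. Symmetry of `H`
merges the two cross terms; no convexity of the quadratic part is used. -/
theorem first_order_of_minimizer {α β : Type*} [MetricSpace α] [SecondCountableTopology α]
    [MeasurableSpace α] [BorelSpace α] [MeasurableSpace β] {K : Set α} (hK : IsCompact K)
    {π : α → β} (hπ : Measurable π) {μ : Measure β}
    {f : α → ℝ} (hf : ContinuousOn f K) {H : α × α → ℝ} (hH : ContinuousOn H (K ×ˢ K))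
    (hsymm : ∀ p ∈ K, ∀ q ∈ K, H (p, q) = H (q, p)) {γ γ' : Measure α}
    (hγ : IsProbabilityMeasure γ ∧ γ Kᶜ = 0 ∧ γ.map π = μ)
    (hγ' : IsProbabilityMeasure γ' ∧ γ' Kᶜ = 0 ∧ γ'.map π = μ)
    (hmin : ∀ γ' : Measure α, IsProbabilityMeasure γ' ∧ γ' Kᶜ = 0 ∧ γ'.map π = μ →
        (∫ p, f p ∂γ) + ∫ p, H p ∂γ.prod γ ≤ (∫ p, f p ∂γ') + ∫ p, H p ∂γ'.prod γ') :
    ∫ p, (f p + 2 * ∫ q, H (p, q) ∂γ) ∂γ ≤ ∫ p, (f p + 2 * ∫ q, H (p, q) ∂γ) ∂γ' := by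
  have h1 := hγ.1
  have h2 := hγ'.1
  have hKK := hK.prod hK
  have if0 := integrable_of_continuousOn_compact hK hγ.2.1 hf
  have if1 := integrable_of_continuousOn_compact hK hγ'.2.1 hf
  have i00 := integrable_of_continuousOn_compact hKK (prod_compl_null hγ.2.1 hγ.2.1) hH
  have i01 := integrable_of_continuousOn_compact hKK (prod_compl_null hγ.2.1 hγ'.2.1) hH
  have i10 := integrable_of_continuousOn_compact hKK (prod_compl_null hγ'.2.1 hγ.2.1) hH
  have i11 := integrable_of_continuousOn_compact hKK (prod_compl_null hγ'.2.1 hγ'.2.1) hH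
  have hswap : ∫ p, H p ∂γ.prod γ' = ∫ p, H p ∂γ'.prod γ := by
    rw [← integral_prod_swap]
    have hae : ∀ᵐ p ∂γ'.prod γ, p ∈ K ×ˢ K := by
      rw [ae_iff]; exact prod_compl_null hγ'.2.1 hγ.2.1
    refine integral_congr_ae (hae.mono fun p hp => ?_)
    exact hsymm p.2 hp.2 p.1 hp.1
  have hcomb : ∀ a b : ℝ≥0, a + b = 1 →
      (∫ p, f p ∂γ) + ∫ p, H p ∂γ.prod γ ≤ (a * (∫ p, f p ∂γ) + b * ∫ p, f p ∂γ') +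
        (a * (a * (∫ p, H p ∂γ.prod γ) + b * ∫ p, H p ∂γ.prod γ') +
          b * (a * (∫ p, H p ∂γ'.prod γ) + b * ∫ p, H p ∂γ'.prod γ')) := by
    intro a b hab
    have hμe : μ = a • μ + b • μ := by rw [← add_smul, hab, one_smul]
    have hprob : IsProbabilityMeasure (a • γ + b • γ') := ⟨by
      rw [Measure.add_apply, Measure.smul_apply, Measure.smul_apply, measure_univ, measure_univ,
        ← add_smul, hab, one_smul]⟩
    have := hmin (a • γ + b • γ') ⟨hprob, by
        rw [Measure.add_apply, Measure.smul_apply, Measure.smul_apply, hγ.2.1, hγ'.2.1]; simp, by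
        rw [Measure.map_add _ _ hπ, Measure.map_smul, Measure.map_smul, hγ.2.2, hγ'.2.2, ← hμe]⟩
    have hprod : (a • γ + b • γ').prod (a • γ + b • γ') =
        a • (a • γ.prod γ + b • γ.prod γ') + b • (a • γ'.prod γ + b • γ'.prod γ') := by
      rw [Measure.add_prod, Measure.prod_smul_left, Measure.prod_smul_left, Measure.prod_add,
        Measure.prod_add]
      simp only [Measure.prod_smul_right]
    rw [hprod, integral_add_measure if0.smul_measure_nnreal if1.smul_measure_nnreal,
      integral_add_measure
        (i00.smul_measure_nnreal.add_measure i01.smul_measure_nnreal).smul_measure_nnreal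
        (i10.smul_measure_nnreal.add_measure i11.smul_measure_nnreal).smul_measure_nnreal] at this
    simp only [integral_smul_nnreal_measure] at this
    rw [integral_add_measure i00.smul_measure_nnreal i01.smul_measure_nnreal,
      integral_add_measure i10.smul_measure_nnreal i11.smul_measure_nnreal] at this
    simpa only [integral_smul_nnreal_measure, NNReal.smul_def, smul_eq_mul] using this
  have hlin : ∀ t : ℝ, 0 < t → t < 1 → 0 ≤ ((∫ p, f p ∂γ') - (∫ p, f p ∂γ) -
      2 * (∫ p, H p ∂γ.prod γ) + 2 * ∫ p, H p ∂γ'.prod γ) + t * ((∫ p, H p ∂γ.prod γ) -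
      2 * (∫ p, H p ∂γ'.prod γ) + ∫ p, H p ∂γ'.prod γ') := by
    intro t ht0 ht1
    obtain ⟨a, ha⟩ : ∃ a : ℝ≥0, (a : ℝ) = 1 - t := ⟨⟨1 - t, by linarith⟩, rfl⟩
    obtain ⟨b, hb⟩ : ∃ b : ℝ≥0, (b : ℝ) = t := ⟨⟨t, ht0.le⟩, rfl⟩
    have := hcomb a b (NNReal.eq (by rw [NNReal.coe_add, ha, hb, NNReal.coe_one]; ring))
    rw [hswap, ha, hb] at this
    refine nonneg_of_mul_nonneg_right ?_ ht0
    linarith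
  have hfirst : 0 ≤ (∫ p, f p ∂γ') - (∫ p, f p ∂γ) -
      2 * (∫ p, H p ∂γ.prod γ) + 2 * ∫ p, H p ∂γ'.prod γ := by
    generalize (∫ p, f p ∂γ') - (∫ p, f p ∂γ) -
      2 * (∫ p, H p ∂γ.prod γ) + 2 * ∫ p, H p ∂γ'.prod γ = A at hlin ⊢
    generalize (∫ p, H p ∂γ.prod γ) -
      2 * (∫ p, H p ∂γ'.prod γ) + ∫ p, H p ∂γ'.prod γ' = B at hlin
    have ht : Tendsto (fun t : ℝ => A + t * B) (𝓝[>] 0) (𝓝 (A + 0 * B)) :=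
      (tendsto_const_nhds.add (tendsto_id.mul tendsto_const_nhds)).mono_left nhdsWithin_le_nhds
    rw [zero_mul, add_zero] at ht
    refine ge_of_tendsto ht ?_
    filter_upwards [Ioo_mem_nhdsGT (zero_lt_one (α := ℝ))] with t ht using hlin t ht.1 ht.2
  rw [integral_add if0 (i00.integral_prod_left.const_mul 2),
    integral_add if1 (i10.integral_prod_left.const_mul 2), integral_const_mul, integral_const_mul,
    ← integral_prod _ i00, ← integral_prod _ i10]
  linarith

theorem isProbabilityMeasure_of_mem_plans {μ : Measure (E m)} {ν : Measure (E n)}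
    [IsProbabilityMeasure μ] {γ : Measure (E m × E n)} (hγ : γ ∈ plans μ ν) :
    IsProbabilityMeasure γ := by
  refine ⟨?_⟩
  rw [← preimage_univ (f := (Prod.fst : E m × E n → E m)),
    ← Measure.map_apply measurable_fst MeasurableSet.univ, hγ.1, measure_univ]

section Minimizer

variable {c : E m → E n → ℝ} {V : E n → ℝ} {W : E n → E n → ℝ} {S : Set (E m)} {T : Set (E n)}
  (hS : IsCompact S) (hT : IsCompact T)
  (hc : ContinuousOn (fun p : E m × E n => c p.1 p.2) (S ×ˢ T)) (hV : ContinuousOn V T)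
  (hW : ContinuousOn (fun p : E n × E n => W p.1 p.2) (T ×ˢ T)) {μ : Measure (E m)}
  (hμ : μ ∈ probOn S)

/-- The energy of a transport plan. -/
noncomputable def planEnergy (c : E m → E n → ℝ) (V : E n → ℝ) (W : E n → E n → ℝ)
    (γ : Measure (E m × E n)) : ℝ :=
  (∫ p, (c p.1 p.2 + V p.2) ∂γ) + ∫ p, (1 / 2) * W p.1.2 p.2.2 ∂γ.prod γ

include hS hT hc hV hW hμ

theorem planEnergy_eq {ν : Measure (E n)} (hν : ν ∈ probOn T) {γ : Measure (E m × E n)}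
    (hγ : γ ∈ plans μ ν) : planEnergy c V W γ = (∫ p, c p.1 p.2 ∂γ) + (∫ y, V y ∂ν) +
      (1 / 2) * ∫ y, (∫ z, W y z ∂ν) ∂ν := by
  have := hμ.1
  have := hν.1
  have := isProbabilityMeasure_of_mem_plans hγ
  have hγ0 : γ (S ×ˢ T)ᶜ = 0 := by
    have := ae_mem_of_mem_plans hμ hν hγ
    rwa [ae_iff] at this
  have hWi : Integrable (fun p : E n × E n => W p.1 p.2) (ν.prod ν) :=
    integrable_of_continuousOn_compact (hT.prod hT) (prod_compl_null hν.2 hν.2) hW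
  have hVi : Integrable V ν := integrable_of_continuousOn_compact hT hν.2 hV
  have hV2 : ∫ p, V p.2 ∂γ = ∫ y, V y ∂ν := by
    have h := hVi.aestronglyMeasurable
    rw [← hγ.2] at h ⊢
    exact (integral_map measurable_snd.aemeasurable h).symm
  have hW2 : ∫ p, W p.1.2 p.2.2 ∂γ.prod γ = ∫ y, (∫ z, W y z ∂ν) ∂ν := by
    rw [← integral_prod _ hWi]
    have h := hWi.aestronglyMeasurable
    rw [← hγ.2, Measure.map_prod_map _ _ measurable_snd measurable_snd] at h ⊢
    exact (integral_map (measurable_snd.prodMap measurable_snd).aemeasurable h).symm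
  rw [planEnergy, integral_add, hV2, integral_const_mul, hW2]
  · exact integrable_of_continuousOn_compact (hS.prod hT) hγ0 hc
  · exact integrable_of_continuousOn_compact (hS.prod hT) hγ0
      (hV.comp continuousOn_snd fun p hp => hp.2)

/-- Only the first marginal is prescribed, and `ν` is whatever second marginal the minimizer has. In
the first-order condition the factor `2` cancels the `1/2` of the interaction, which turns the
linearized integrand into `c + F[ν]`. -/
theorem exists_plan_minimizer (hTn : T.Nonempty) (hWs : ∀ y ∈ T, ∀ z ∈ T, W y z = W z y) :
    ∃ γ : Measure (E m × E n), ∃ ν ∈ probOn T, γ ∈ plans μ ν ∧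
      (∀ ν' ∈ probOn T, ∀ γ' ∈ plans μ ν', planEnergy c V W γ ≤ planEnergy c V W γ') ∧
      ∀ ν' ∈ probOn T, ∀ γ' ∈ plans μ ν',
        ∫ p, (c p.1 p.2 + firstVar V W ν p.2) ∂γ ≤ ∫ p, (c p.1 p.2 + firstVar V W ν p.2) ∂γ' := by
  have := hμ.1
  have hK := hS.prod hT
  have hf : ContinuousOn (fun p : E m × E n => c p.1 p.2 + V p.2) (S ×ˢ T) :=
    hc.add (hV.comp continuousOn_snd fun p hp => hp.2)
  have hH : ContinuousOn (fun p : (E m × E n) × (E m × E n) => (1 / 2) * W p.1.2 p.2.2)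
      ((S ×ˢ T) ×ˢ (S ×ˢ T)) :=
    continuousOn_const.mul (hW.comp (f := fun p : (E m × E n) × (E m × E n) => (p.1.2, p.2.2))
      (by fun_prop) fun p hp => ⟨hp.1.2, hp.2.2⟩)
  have hplan : ∀ ν' ∈ probOn T, ∀ γ' ∈ plans μ ν',
      IsProbabilityMeasure γ' ∧ γ' (S ×ˢ T)ᶜ = 0 ∧ γ'.map Prod.fst = μ := by
    intro ν' hν' γ' hγ'
    have h := ae_mem_of_mem_plans hμ hν' hγ'
    rw [ae_iff] at h
    exact ⟨isProbabilityMeasure_of_mem_plans hγ', h, hγ'.1⟩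
  obtain ⟨y, hy⟩ := hTn
  have hdirac : Measure.dirac y ∈ probOn T :=
    ⟨inferInstance, by rw [Measure.dirac_apply' _ hT.measurableSet.compl]; simp [hy]⟩
  obtain ⟨γ, hγ, hmin⟩ := exists_minimizer_of_compact hK continuous_fst hf hH
    ⟨_, hplan _ hdirac (μ.prod (Measure.dirac y)) prod_mem_plans⟩
  have := hγ.1
  have hν : γ.map Prod.snd ∈ probOn T := by
    refine ⟨Measure.isProbabilityMeasure_map measurable_snd.aemeasurable, ?_⟩
    rw [Measure.map_apply measurable_snd hT.measurableSet.compl]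
    exact measure_mono_null (t := (S ×ˢ T)ᶜ)
      (fun p (hp : p.2 ∈ Tᶜ) (h : p ∈ S ×ˢ T) => hp h.2) hγ.2.1
  refine ⟨γ, _, hν, ⟨hγ.2.2, rfl⟩, fun ν' hν' γ' hγ' => hmin γ' (hplan ν' hν' γ' hγ'),
    fun ν' hν' γ' hγ' => ?_⟩
  have hfo := first_order_of_minimizer hK measurable_fst hf hH
    (fun p hp q hq => by simp only [hWs p.2 hp.2 q.2 hq.2]) hγ (hplan ν' hν' γ' hγ') hmin
  have hpt : ∀ p ∈ S ×ˢ T, c p.1 p.2 + V p.2 + 2 * ∫ q, (1 / 2) * W p.2 q.2 ∂γ =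
      c p.1 p.2 + firstVar V W (γ.map Prod.snd) p.2 := by
    intro p hp
    have hi : Integrable (fun z => W p.2 z) (γ.map Prod.snd) :=
      integrable_of_continuousOn_compact hT hν.2
        (hW.comp (f := fun z => (p.2, z)) (by fun_prop) fun z hz => ⟨hp.2, hz⟩)
    rw [firstVar, integral_map measurable_snd.aemeasurable hi.aestronglyMeasurable,
      integral_const_mul]
    ring
  have hcongr : ∀ γ₁ : Measure (E m × E n), γ₁ (S ×ˢ T)ᶜ = 0 →
      ∫ p, (c p.1 p.2 + V p.2 + 2 * ∫ q, (1 / 2) * W p.2 q.2 ∂γ) ∂γ₁ =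
        ∫ p, (c p.1 p.2 + firstVar V W (γ.map Prod.snd) p.2) ∂γ₁ := by
    intro γ₁ h₁
    have hae : ∀ᵐ p ∂γ₁, p ∈ S ×ˢ T := by rw [ae_iff]; exact h₁
    exact integral_congr_ae (hae.mono hpt)
  rwa [hcongr γ hγ.2.1, hcongr γ' (hplan ν' hν' γ' hγ').2.1] at hfo

theorem isMinOn_energy_of_plan_minimizer {γ : Measure (E m × E n)} {ν : Measure (E n)}
    (hν : ν ∈ probOn T) (hγ : γ ∈ plans μ ν)
    (hmin : ∀ ν' ∈ probOn T, ∀ γ' ∈ plans μ ν', planEnergy c V W γ ≤ planEnergy c V W γ') :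
    IsMinOn (energy c V W μ) (probOn T) ν := by
  have := hμ.1
  obtain ⟨K, hK⟩ := (hS.prod hT).exists_bound_of_continuousOn hc
  -- The transport cost is a real `sInf`, meaningful only once the set is bounded below.
  have hbdd : BddBelow ((fun γ : Measure (E m × E n) => ∫ p, c p.1 p.2 ∂γ) '' plans μ ν) := by
    refine ⟨-K, ?_⟩
    rintro _ ⟨γ', hγ', rfl⟩
    have := isProbabilityMeasure_of_mem_plans hγ'
    have h := norm_integral_le_of_norm_le_const (μ := γ') (f := fun p => c p.1 p.2) (C := K)
      ((ae_mem_of_mem_plans hμ hν hγ').mono hK)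
    simp only [probReal_univ, mul_one] at h
    exact (abs_le.1 h).1
  intro ν' hν'
  have := hν'.1
  have h1 : transportCost c μ ν ≤ ∫ p, c p.1 p.2 ∂γ := csInf_le hbdd ⟨γ, hγ, rfl⟩
  have h2 : planEnergy c V W γ - (∫ y, V y ∂ν') - (1 / 2) * (∫ y, (∫ z, W y z ∂ν') ∂ν') ≤
      transportCost c μ ν' := by
    refine le_csInf ⟨_, _, prod_mem_plans, rfl⟩ ?_
    rintro _ ⟨γ', hγ', rfl⟩
    have := hmin ν' hν' γ' hγ'
    rw [planEnergy_eq hS hT hc hV hW hμ hν' hγ'] at this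
    simp only
    linarith
  have h3 := planEnergy_eq hS hT hc hV hW hμ hν hγ
  simp only [mem_ofPred_eq, energy]
  linarith

end Minimizer

/-- A plan that is optimal against the pointwise reply is carried by the graph of the reply. -/
theorem eq_map_of_plan_le {S : Set (E m)} {T : Set (E n)} (hS : IsCompact S) (hT : IsCompact T)
    (hXS : X ⊆ S) {L : E m → E n → ℝ}
    (hL : ContinuousOn (fun p : E m × E n => L p.1 p.2) (S ×ˢ T)) {μ : Measure (E m)}
    (hμ : μ ∈ probOn X) {ν : Measure (E n)} (hν : ν ∈ probOn T) {γ : Measure (E m × E n)}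
    (hγ : γ ∈ plans μ ν) {B : E m → E n} (hB : AEMeasurable B μ) (hBT : MapsTo B X T)
    (hBmin : ∀ x ∈ X, IsMinOn (L x) T (B x))
    (hBuniq : ∀ x ∈ X, ∀ y ∈ T, IsMinOn (L x) T y → y = B x)
    (hle : ∀ ν' ∈ probOn T, ∀ γ' ∈ plans μ ν', ∫ p, L p.1 p.2 ∂γ ≤ ∫ p, L p.1 p.2 ∂γ') :
    μ.map B = ν := by
  have := hμ.1
  have hμS : μ ∈ probOn S := ⟨hμ.1, measure_mono_null (compl_subset_compl.2 hXS) hμ.2⟩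
  have hint : ∀ {ν' : Measure (E n)}, ν' ∈ probOn T → ∀ {γ' : Measure (E m × E n)},
      γ' ∈ plans μ ν' → Integrable (fun p : E m × E n => L p.1 p.2) γ' := by
    intro ν' hν' γ' hγ'
    have := isProbabilityMeasure_of_mem_plans hγ'
    have h := ae_mem_of_mem_plans hμS hν' hγ'
    rw [ae_iff] at h
    exact integrable_of_continuousOn_compact (hS.prod hT) h hL
  have hBν : μ.map B ∈ probOn T := map_mem_probOn hT.measurableSet hμ hB hBT
  have hgraph : μ.map (fun x => (x, B x)) ∈ plans μ (μ.map B) := by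
    simpa using map_prodMk_mem_plans (aemeasurable_id (μ := μ)) hB
  have hγB : AEMeasurable (fun p : E m × E n => B p.1) γ := by
    rw [← hγ.1] at hB
    exact hB.comp_measurable measurable_fst
  have hpair : AEMeasurable (fun x => (x, B x)) μ := aemeasurable_id.prodMk hB
  have hLB : Integrable (fun x => L x (B x)) μ :=
    (integrable_map_measure (hint hBν hgraph).aestronglyMeasurable hpair).1 (hint hBν hgraph)
  have hLBγ : Integrable (fun p : E m × E n => L p.1 (B p.1)) γ := by
    have h := hLB
    rw [← hγ.1] at h
    exact (integrable_map_measure h.aestronglyMeasurable measurable_fst.aemeasurable).1 h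
  have heq : ∫ p, L p.1 p.2 ∂μ.map (fun x => (x, B x)) = ∫ p, L p.1 (B p.1) ∂γ := by
    rw [integral_map hpair (hint hBν hgraph).aestronglyMeasurable]
    have h := hLB.aestronglyMeasurable
    rw [← hγ.1] at h
    have := integral_map measurable_fst.aemeasurable h
    rwa [hγ.1] at this
  have hmem : ∀ᵐ p ∂γ, p ∈ X ×ˢ T := ae_mem_of_mem_plans hμ hν hγ
  have hnonneg : 0 ≤ᵐ[γ] fun p => L p.1 p.2 - L p.1 (B p.1) :=
    hmem.mono fun p hp => sub_nonneg.2 (hBmin p.1 hp.1 hp.2)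
  -- The competitor is the graph plan of `B`: its cost is the `γ`-integral of the pointwise minimum,
  -- since `γ` has first marginal `μ`.
  have hzero : ∫ p, (L p.1 p.2 - L p.1 (B p.1)) ∂γ = 0 := by
    refine le_antisymm ?_ (integral_nonneg_of_ae hnonneg)
    rw [integral_sub (hint hν hγ) hLBγ, ← heq]
    exact sub_nonpos.2 (hle _ hBν _ hgraph)
  have hae := (integral_eq_zero_iff_of_nonneg_ae hnonneg ((hint hν hγ).sub hLBγ)).1 hzero
  have hsnd : Prod.snd =ᵐ[γ] fun p : E m × E n => B p.1 := by
    filter_upwards [hae, hmem] with p hp hpm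
    refine hBuniq p.1 hpm.1 p.2 hpm.2 fun y hy => ?_
    have h0 : L p.1 p.2 - L p.1 (B p.1) = 0 := hp
    have h1 : L p.1 (B p.1) ≤ L p.1 y := hBmin p.1 hpm.1 hy
    show L p.1 p.2 ≤ L p.1 y
    linarith
  rw [← hγ.2, Measure.map_congr hsnd]
  rw [← hγ.1] at hB ⊢
  exact AEMeasurable.map_map_of_aemeasurable hB measurable_fst.aemeasurable

end BestReply

/-! ### The contraction and its fixed point -/

theorem mainTheorem9 {m n : ℕ} (hmn : n < m)
    -- the domains
    (X : Set (BestReply.E m)) (hXo : IsOpen X) (hXb : Bornology.IsBounded X)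
    (Y : Set (BestReply.E n)) (hYo : IsOpen Y) (hYb : Bornology.IsBounded Y)
    (hYc : Convex ℝ Y) (hYn : Y.Nonempty)
    -- the cost, the potential and the symmetric interaction, of class C² up to the boundary in y
    (c : BestReply.E m → BestReply.E n → ℝ)
    (hc0 : ContinuousOn (fun p : BestReply.E m × BestReply.E n => c p.1 p.2)
      (closure X ×ˢ closure Y))
    (hc2 : ContDiffOn ℝ 2 (fun p : BestReply.E m × BestReply.E n => c p.1 p.2) (X ×ˢ closure Y))
    (V : BestReply.E n → ℝ) (hV : ContDiffOn ℝ 2 V (closure Y))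
    (W : BestReply.E n → BestReply.E n → ℝ)
    (hW : ContDiffOn ℝ 2 (fun p : BestReply.E n × BestReply.E n => W p.1 p.2)
      (closure Y ×ˢ closure Y))
    (hWs : ∀ y ∈ closure Y, ∀ z ∈ closure Y, W y z = W z y)
    -- outward gradients on the boundary
    (hout : ∀ x ∈ X, ∀ z ∈ Y, ∀ y ∈ frontier Y, ∀ e, BestReply.IsOutwardUnitNormal Y y e →
      0 ≤ inner ℝ (BestReply.grad Y (c x) y + BestReply.grad Y V y +
        BestReply.grad Y (fun y' => W y' z) y) e)
    -- uniform convexity of the cost in y, and maximal rank of its mixed second derivative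
    (η : ℝ) (hη : 0 < η)
    (hcη : ∀ x ∈ X, ∀ y ∈ Y, ∀ v, η * ‖v‖ ^ 2 ≤ BestReply.hess Y (c x) y v)
    (hrank : ∀ x ∈ X, ∀ y ∈ Y, Module.finrank ℝ (BestReply.mixed Y c x y).range = n)
    -- uniform convexity of the first variation
    (lam : ℝ) (hlam : 0 < lam)
    (hFlam : ∀ ν ∈ BestReply.probOn (closure Y), ∀ y ∈ Y, ∀ v,
      lam * ‖v‖ ^ 2 ≤ BestReply.hess Y (BestReply.firstVar V W ν) y v)
    -- bound on the fibres of B_ν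
    (M : ℝ≥0)
    (hM : ∀ ν ∈ BestReply.probOn (closure Y), ∀ y ∈ Y,
      Measure.euclideanHausdorffMeasure (m - n) {x ∈ X | BestReply.reply Y c V W ν x = y} ≤ M)
    -- lower bound on the Jacobian of B_ν
    (k : ℝ) (hk : 0 < k)
    (hJ : ∀ ν ∈ BestReply.probOn (closure Y), ∀ x ∈ X,
      k ≤ BestReply.jac (fderiv ℝ (BestReply.reply Y c V W ν) x))
    -- Lipschitz bound on the gradient of the first variation
    (C : ℝ≥0)
    (hC : ∀ ν₁ ∈ BestReply.probOn (closure Y), ∀ ν₀ ∈ BestReply.probOn (closure Y),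
      ∫⁻ y in Y, ‖BestReply.grad Y (BestReply.firstVar V W ν₁) y -
        BestReply.grad Y (BestReply.firstVar V W ν₀) y‖ₑ ≤ C * BestReply.W1 ν₁ ν₀)
    -- the fixed marginal
    (μ : Measure (BestReply.E m)) (hμ : μ ∈ BestReply.probOn X) (hμac : μ ≪ volume)
    (hsmall : essSup (μ.rnDeriv volume) volume * M * C < ENNReal.ofReal (k * (η + lam))) :
    -- B_ν is well defined on X
    (∀ ν ∈ BestReply.probOn (closure Y), ∀ x ∈ X, ∃! y, BestReply.IsReply Y c V W ν x y) ∧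
    -- the best-reply map is a contraction for the 1-Wasserstein distance
    MapsTo (BestReply.bestReply Y c V W μ)
      (BestReply.probOn (closure Y)) (BestReply.probOn (closure Y)) ∧
    (∃ q : ℝ≥0, q < 1 ∧
      ∀ ν₁ ∈ BestReply.probOn (closure Y), ∀ ν₀ ∈ BestReply.probOn (closure Y),
        BestReply.W1 (BestReply.bestReply Y c V W μ ν₁) (BestReply.bestReply Y c V W μ ν₀) ≤
          q * BestReply.W1 ν₁ ν₀) ∧
    -- it has exactly one fixed point, and that fixed point minimizes the energy
    ∃ ν' ∈ BestReply.probOn (closure Y),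
      BestReply.bestReply Y c V W μ ν' = ν' ∧
      (∀ ν ∈ BestReply.probOn (closure Y), BestReply.bestReply Y c V W μ ν = ν → ν = ν') ∧
      IsMinOn (BestReply.energy c V W μ) (BestReply.probOn (closure Y)) ν' := by
  open BestReply in
  have hSY := hYb.isCompact_closure
  have hSX := hXb.isCompact_closure
  have hμ1 := hμ.1
  have hμS : μ ∈ probOn (closure X) :=
    ⟨hμ.1, measure_mono_null (compl_subset_compl.2 subset_closure) hμ.2⟩
  have huniq : ∀ ν ∈ probOn (closure Y), ∀ x ∈ X, ∃! y, IsReply Y c V W ν x y :=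
    fun ν hν x hx => existsUnique_isReply hYo hYb hYc hYn hV hW hν (contDiffOn_slice hc2 hx) hη
      (hcη x hx) hlam (hFlam ν hν) fun z hz y hy e he => hout x hx z hz y hy e he
  have hspec : ∀ ν ∈ probOn (closure Y), ∀ x ∈ X, IsReply Y c V W ν x (reply Y c V W ν x) :=
    fun ν hν x hx => reply_spec (huniq ν hν x hx).exists
  have hmapsS : ∀ ν ∈ probOn (closure Y), MapsTo (reply Y c V W ν) X (closure Y) :=
    fun ν hν x hx => (hspec ν hν x hx).1
  have hjpos : ∀ ν ∈ probOn (closure Y), ∀ x ∈ X, 0 < jac (fderiv ℝ (reply Y c V W ν) x) :=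
    fun ν hν x hx => hk.trans_le (hJ ν hν x hx)
  have hmapsY : ∀ ν ∈ probOn (closure Y), MapsTo (reply Y c V W ν) X Y :=
    fun ν hν x hx => mem_of_jac_pos hXo hYo hYc hYn (hmapsS ν hν) hx (hjpos ν hν x hx)
  have hmeas : ∀ ν ∈ probOn (closure Y), AEMeasurable (reply Y c V W ν) μ :=
    fun ν hν => aemeasurable_reply hXo hμ (hjpos ν hν)
  have hmaps : MapsTo (bestReply Y c V W μ) (probOn (closure Y)) (probOn (closure Y)) :=
    fun ν hν => map_mem_probOn isClosed_closure.measurableSet hμ (hmeas ν hν) (hmapsS ν hν)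
  have hkpos : 0 < k * (η + lam) := by positivity
  set D := ENNReal.ofReal (k * (η + lam)) with hD
  have hD0 : D ≠ 0 := (ENNReal.ofReal_pos.2 hkpos).ne'
  have hDt : D ≠ ∞ := ENNReal.ofReal_ne_top
  set A := essSup (μ.rnDeriv volume) volume * M * C with hA
  have hq1 : A / D < 1 := (ENNReal.div_lt_iff (Or.inl hD0) (Or.inl hDt)).2 (by rwa [one_mul])
  -- Stated for the `L¹(μ)` distance of the reply maps, which is stronger than the bound on `W1` and
  -- is needed again for uniqueness.
  have hcontr : ∀ ν₁ ∈ probOn (closure Y), ∀ ν₀ ∈ probOn (closure Y),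
      ∫⁻ x, edist (reply Y c V W ν₁ x) (reply Y c V W ν₀ x) ∂μ ≤ A / D * W1 ν₁ ν₀ := by
    intro ν₁ h₁ ν₀ h₀
    have hG : ContinuousOn (fun y => grad Y (firstVar V W ν₁) y - grad Y (firstVar V W ν₀) y) Y :=
      ((continuousOn_grad_firstVar hYo hYb hYc hYn hV hW h₁).sub
        (continuousOn_grad_firstVar hYo hYb hYc hYn hV hW h₀)).mono subset_closure
    have h := mul_lintegral_edist_le hmn.le hXo hYo hμ hμac hk (hmapsY ν₀ h₀) (hJ ν₀ h₀)
      (hM ν₀ h₀) hG (a := η + lam) (by positivity) (f₁ := reply Y c V W ν₁) fun x hx =>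
        norm_sub_le_of_isReply hYo hYb hYc hYn hV hW h₁ (contDiffOn_slice hc2 hx) hη
          (hcη x hx) hlam (hFlam ν₁ h₁) (hspec ν₁ h₁ x hx) (hspec ν₀ h₀ x hx)
    rw [← ENNReal.mul_div_right_comm, ENNReal.le_div_iff_mul_le (Or.inl hD0) (Or.inl hDt), mul_comm]
    refine h.trans ?_
    rw [hA, mul_assoc _ (C : ℝ≥0∞)]
    exact mul_le_mul_right (hC ν₁ h₁ ν₀ h₀) _
  have hqc : ((A / D).toNNReal : ℝ≥0∞) = A / D := ENNReal.coe_toNNReal (ne_top_of_lt hq1)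
  refine ⟨huniq, hmaps, ⟨(A / D).toNNReal, ?_, fun ν₁ h₁ ν₀ h₀ => ?_⟩, ?_⟩
  · rw [← ENNReal.coe_lt_one_iff, hqc]
    exact hq1
  · rw [hqc]
    exact (W1_map_le (hmeas ν₁ h₁) (hmeas ν₀ h₀)).trans (hcontr ν₁ h₁ ν₀ h₀)
  obtain ⟨γ, ν', hν', hγ, hmin, hfo⟩ := exists_plan_minimizer hSX hSY hc0 hV.continuousOn
    hW.continuousOn hμS hYn.closure hWs
  have hF : ContinuousOn (firstVar V W ν') (closure Y) := fun y hy =>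
    (hasFDerivWithinAt_firstVar hYo hYb hYc hYn hV hW hν' hy).continuousWithinAt
  have hL : ContinuousOn (fun p : E m × E n => c p.1 p.2 + firstVar V W ν' p.2)
      (closure X ×ˢ closure Y) := hc0.add (hF.comp continuousOn_snd fun p hp => hp.2)
  have hminReply : ∀ x ∈ X, ∀ y ∈ closure Y,
      IsMinOn (fun y => c x y + firstVar V W ν' y) (closure Y) y → y = reply Y c V W ν' x :=
    fun x hx y hy hy' => (huniq ν' hν' x hx).unique
      (isReply_of_isMinOn hYo hYb hYc hYn hV hW hν' (contDiffOn_slice hc2 hx)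
        (fun z hz y hy e he => hout x hx z hz y hy e he) hy hy') (hspec ν' hν' x hx)
  have hreplyMin : ∀ x ∈ X,
      IsMinOn (fun y => c x y + firstVar V W ν' y) (closure Y) (reply Y c V W ν' x) := by
    intro x hx
    obtain ⟨y, hy, hy'⟩ := hSY.exists_isMinOn hYn.closure
      ((contDiffOn_slice hc2 hx).continuousOn.add hF)
    exact hminReply x hx y hy hy' ▸ hy'
  have hfix : bestReply Y c V W μ ν' = ν' :=
    eq_map_of_plan_le hSX hSY subset_closure (L := fun x y => c x y + firstVar V W ν' y) hL hμ hν' hγ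
      (hmeas ν' hν') (hmapsS ν' hν') hreplyMin hminReply hfo
  refine ⟨ν', hν', hfix, fun ν hν hνfix => ?_,
    isMinOn_energy_of_plan_minimizer hSX hSY hc0 hV.continuousOn hW.continuousOn hμS hν' hγ hmin⟩
  -- Finiteness of the distance makes the strict contraction force it to vanish. Equality of the
  -- measures then follows from `hcontr`: the replies agree `μ`-a.e., hence so do their
  -- push-forwards. That `W1` separates measures is not used.
  have hW0 : W1 ν ν' = 0 := by
    have hlt : W1 ν ν' < ∞ := W1_lt_top hSY.isBounded hν hν'
    have hle : W1 ν ν' ≤ A / D * W1 ν ν' := by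
      conv_lhs => rw [← hνfix, ← hfix]
      exact (W1_map_le (hmeas ν hν) (hmeas ν' hν')).trans (hcontr ν hν ν' hν')
    by_contra h0
    have : A / D * W1 ν ν' < 1 * W1 ν ν' := ENNReal.mul_lt_mul_left h0 hlt.ne hq1
    rw [one_mul] at this
    exact absurd hle this.not_ge
  have hae : reply Y c V W ν =ᵐ[μ] reply Y c V W ν' := by
    have h := hcontr ν hν ν' hν'
    rw [hW0, mul_zero, nonpos_iff_eq_zero,
      lintegral_eq_zero_iff' ((hmeas ν hν).edist (hmeas ν' hν'))] at h
    filter_upwards [h] with x hx using edist_eq_zero.1 hx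
  rw [← hνfix, ← hfix]
  exact Measure.map_congr hae
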